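/- For a square-free integer $d \neq \pm 3$ (positive or negative), let $C_d$ be the smooth projective genus $2$ curve over $\mathbb{Q}$ with affine equation $y^2 = f_d(x)$, where \[ f_d(x)=\frac{27(d-3)}{d+3}\left(x^6-\frac{12d}{d-3}x^5-5dx^4+\frac{40d^2}{3(d-3)}x^3+\frac{5d^2}{3}x^2-\frac{4d^3}{3(d-3)}x-\frac{d^3}{27}\right). \] Let $K_d \subset \overline{\mathbb{Q}}$ be the field of definition of the automorphisms of $C_d$, that is, the fixed field of the kernel of the action of $\mathrm{Gal}(\overline{\mathbb{Q}}/\mathbb{Q})$ on $\mathrm{Aut}_{\overline{\mathbb{Q}}}(C_d)$. For a hyperelliptic curve $C: y^2=f(x)$ over $\mathbb{Q}$, a hyperelliptic twist of $C$ is a curve isomorphic over $\mathbb{Q}$ to $C^{(k)} : ky^2=f(x)$ for some $k\in\mathbb{Q}^\times$. Then: (i) For every square-free integer $d\neq\pm3$ and every root $\alpha_d \in \overline{\mathbb{Q}}$ of $x^3-\frac34x-\frac{d-3}{4(d+3)}$, one has $K_d=\mathbb{Q}(\alpha_d,\sqrt d,\sqrt{-3})$. (ii) If $d_1\neq d_2$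 are square-free integers different from $\pm 3$, then $C_{d_1}$ and $C_{d_2}$ are not hyperelliptic twists of each other. -/

import Mathlib

open Polynomial TensorProduct

noncomputable section

namespace Hyperelliptic

/-! A hyperelliptic curve `k y² = f(x)` over a field `K` means the smooth projective curve with this
affine equation.  It is handled through its function field: isomorphisms over `K` of smooth
projective curves are (contravariantly) the `K`-algebra isomorphisms of their function fields. -/

section Curve

variable {K : Type*} [Field K]

/-- The coordinate ring `K[x, y] / (k y² - f(x))` of the affine curve `k y² = f(x)`.
The inner polynomial variable is `x`, the outer one is `y`. -/
abbrev CoordinateRing (k : K) (f : K[X]) : Type _ :=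
  AdjoinRoot (C (C k) * X ^ 2 - C f : K[X][X])

/-- The function field `K(C)` of the curve `C : k y² = f(x)`. -/
abbrev FunctionField (k : K) (f : K[X]) : Type _ :=
  FractionRing (CoordinateRing k f)

/-- The curves `k y² = f(x)` and `k' y² = f'(x)` are isomorphic over `K`. -/
def IsIsomorphic (k : K) (f : K[X]) (k' : K) (f' : K[X]) : Prop :=
  Nonempty (FunctionField k f ≃ₐ[K] FunctionField k' f')

/-- The curve `y² = g(x)` is a hyperelliptic twist of `y² = f(x)`: it is isomorphic over `K` to
`k y² = f(x)` for some `k ∈ Kˣ`. -/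
def IsHyperellipticTwist (f g : K[X]) : Prop :=
  ∃ k : K, k ≠ 0 ∧ IsIsomorphic 1 g k f

end Curve

section Galois

variable {K : Type*} [Field K] (L : Type*) [Field L] [Algebra K L] (f : K[X])

/-- The function field `L(C) = L ⊗ K(C)` of the base change to `L` of the curve `C : y² = f(x)`. -/
abbrev BaseChangeFunctionField : Type _ :=
  L ⊗[K] FunctionField (1 : K) f

/-- The automorphisms over `L` of the curve `C : y² = f(x)`, acting on `L(C)` by pullback (so the
order of composition is reversed). -/
abbrev AutGroup : Type _ :=
  BaseChangeFunctionField L f ≃ₐ[L] BaseChangeFunctionField L f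

variable {L}

/-- The action of `σ ∈ Gal(L/K)` on `L(C)` through the constants: it fixes `K(C)`. -/
def galoisOnFunctions (σ : L ≃ₐ[K] L) :
    BaseChangeFunctionField L f ≃ₐ[K] BaseChangeFunctionField L f :=
  Algebra.TensorProduct.congr σ AlgEquiv.refl

theorem galoisOnFunctions_tmul (σ : L ≃ₐ[K] L) (a : L) (z : FunctionField (1 : K) f) :
    galoisOnFunctions f σ (a ⊗ₜ[K] z) = σ a ⊗ₜ[K] z := by
  simp [galoisOnFunctions]

theorem galoisOnFunctions_algebraMap (σ : L ≃ₐ[K] L) (a : L) :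
    galoisOnFunctions f σ (algebraMap L (BaseChangeFunctionField L f) a) =
      algebraMap L (BaseChangeFunctionField L f) (σ a) := by
  simp [Algebra.TensorProduct.algebraMap_apply, galoisOnFunctions_tmul]

theorem galoisOnFunctions_one :
    galoisOnFunctions f (1 : L ≃ₐ[K] L) = AlgEquiv.refl := by
  ext z
  induction z using TensorProduct.induction_on with
  | zero => simp
  | tmul a z => rw [galoisOnFunctions_tmul]; rfl
  | add x y hx hy => rw [map_add, hx, hy, map_add]

theorem galoisOnFunctions_mul (σ τ : L ≃ₐ[K] L) (z : BaseChangeFunctionField L f) :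
    galoisOnFunctions f (σ * τ) z = galoisOnFunctions f σ (galoisOnFunctions f τ z) := by
  induction z using TensorProduct.induction_on with
  | zero => simp
  | tmul a z => simp only [galoisOnFunctions_tmul]; rfl
  | add x y hx hy => simp only [map_add, hx, hy]

theorem galoisOnFunctions_inv_apply (σ : L ≃ₐ[K] L) (z : BaseChangeFunctionField L f) :
    galoisOnFunctions f σ (galoisOnFunctions f σ⁻¹ z) = z := by
  rw [← galoisOnFunctions_mul, mul_inv_cancel, galoisOnFunctions_one]; rfl

theorem galoisOnFunctions_apply_inv (σ : L ≃ₐ[K] L) (z : BaseChangeFunctionField L f) :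
    galoisOnFunctions f σ⁻¹ (galoisOnFunctions f σ z) = z := by
  rw [← galoisOnFunctions_mul, inv_mul_cancel, galoisOnFunctions_one]; rfl

/-- The Galois conjugate `σ φ σ⁻¹` of an automorphism `φ` of `C` over `L`. -/
def galoisConj (σ : L ≃ₐ[K] L) (φ : AutGroup L f) : AutGroup L f where
  toFun z := galoisOnFunctions f σ (φ (galoisOnFunctions f σ⁻¹ z))
  invFun z := galoisOnFunctions f σ (φ.symm (galoisOnFunctions f σ⁻¹ z))
  left_inv z := by
    simp only [galoisOnFunctions_apply_inv, AlgEquiv.symm_apply_apply, galoisOnFunctions_inv_apply]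
  right_inv z := by
    simp only [galoisOnFunctions_apply_inv, AlgEquiv.apply_symm_apply, galoisOnFunctions_inv_apply]
  map_mul' x y := by simp only [map_mul]
  map_add' x y := by simp only [map_add]
  commutes' a := by
    rw [galoisOnFunctions_algebraMap, AlgEquiv.commutes, galoisOnFunctions_algebraMap,
      ← AlgEquiv.mul_apply, mul_inv_cancel, AlgEquiv.one_apply]

theorem galoisConj_apply (σ : L ≃ₐ[K] L) (φ : AutGroup L f) (z : BaseChangeFunctionField L f) :
    galoisConj f σ φ z = galoisOnFunctions f σ (φ (galoisOnFunctions f σ⁻¹ z)) := rfl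

variable (L)

/-- The action of `Gal(L/K)` on the group of automorphisms of `C` over `L`. -/
def galoisAction : (L ≃ₐ[K] L) →* MulAut (AutGroup L f) where
  toFun σ :=
    { toFun := galoisConj f σ
      invFun := galoisConj f σ⁻¹
      left_inv := fun φ => by
        ext z
        simp only [galoisConj_apply, inv_inv, galoisOnFunctions_apply_inv]
      right_inv := fun φ => by
        ext z
        simp only [galoisConj_apply, inv_inv, galoisOnFunctions_inv_apply]
      map_mul' := fun φ ψ => by
        ext z
        simp only [galoisConj_apply, AlgEquiv.mul_apply, galoisOnFunctions_apply_inv] }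
  map_one' := by
    ext φ z
    change galoisConj f 1 φ z = φ z
    rw [galoisConj_apply, inv_one, galoisOnFunctions_one]; rfl
  map_mul' σ τ := by
    ext φ z
    change galoisConj f (σ * τ) φ z = galoisConj f σ (galoisConj f τ φ) z
    simp only [galoisConj_apply, mul_inv_rev, galoisOnFunctions_mul]

/-- The field of definition, inside `L`, of the automorphisms of `C : y² = f(x)` over `L`: the
subfield of `L` fixed by all `σ ∈ Gal(L/K)` that act trivially on the automorphism group. -/
def autFieldOfDefinition : IntermediateField K L :=
  IntermediateField.fixedField (galoisAction L f).ker

end Galois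

end Hyperelliptic

/-- The polynomial `f_d` of the curve `C_d : y² = f_d(x)`. -/
def sexticPoly (d : ℚ) : ℚ[X] :=
  C (27 * (d - 3) / (d + 3)) *
    (X ^ 6 - C (12 * d / (d - 3)) * X ^ 5 - C (5 * d) * X ^ 4
      + C (40 * d ^ 2 / (3 * (d - 3))) * X ^ 3 + C (5 * d ^ 2 / 3) * X ^ 2
      - C (4 * d ^ 3 / (3 * (d - 3))) * X - C (d ^ 3 / 27))

/-- The cubic polynomial of which `α_d` is a root. -/
def cubicPoly (d : ℚ) : ℚ[X] :=
  X ^ 3 - C (3 / 4) * X - C ((d - 3) / (4 * (d + 3)))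

end

namespace Hyperelliptic

/-! ### Function fields of hyperelliptic curves as presentations by two coordinates -/

section Presentation

variable {K : Type*} [Field K]

/-! Write d = -3p². Then f_d = A(x - p)⁶ + B(x + p)⁶ with A = `sexticCoeff p` and B = `sexticCoeff
(-p)` (`coeff_sexticPoly`), so everything is governed by the two points ±p of the projective line.

Isomorphisms between curves y² = sextic are matrices: u = (ax + b)/(cx + e), v = (ae - bc)y/(cx +
e)³, carrying one binary sextic form to (ae - bc)² times the other
(`IsPresentation.exists_moebius`). The reason is that du/v and u du/v are regular everywhere, hence
combinations of dx/y and x dx/y. Regularity is tested on valuation rings stable under δ = y d/dx; on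
each affine chart it forces the ratio to dx/y to be a polynomial in the coordinates, and comparing
the two charts leaves only polynomials of degree at most one in x.

A substitution between two sums of two sixth powers permutes the powers up to constants
(`diagonal_or_antidiagonal_of_forall`). For (ii), a rational matrix therefore carries p₂ or -p₂ to
p₁, so ℚ(p₁) = ℚ(p₂), d₁d₂ is a square, and d₁ = d₂ by square-freeness.

For (i), in coordinates adapted to ±p the automorphisms are diagonal with entries ζ, ±ζ², ζ⁶ = 1, or
antidiagonal with entries b', ±1/b', b'⁶ = B/A. Returning to x brings in p = √d√-3/3. As B/A = ((1 -
p)/(1 + p))², the trigonometric solution of the cubic puts a sixth root of B/A into ℚ(α, p)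
(`exists_sixth_root`). Hence a Galois element acts trivially exactly when it fixes α, √d and √-3
(`mem_ker_galoisAction_sexticPoly_iff`), and the Galois correspondence concludes. -/

theorem eq_zero_of_sq_eq_sq_mul {f : K[X]} (hf : Squarefree f) (hu : ¬ IsUnit f) {a b : K[X]}
    (h : a ^ 2 = b ^ 2 * f) : a = 0 ∧ b = 0 := by
  by_cases hb : b = 0
  · subst hb
    simpa using h
  · obtain ⟨c, rfl⟩ : b ∣ a :=
      (IsIntegrallyClosed.pow_dvd_pow_iff two_ne_zero).1 ⟨f, h⟩
    have hc : c * c = f := mul_left_cancel₀ (pow_ne_zero 2 hb) (by rw [← h]; ring)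
    have hcu : IsUnit c := hf c ⟨1, by rw [hc, mul_one]⟩
    exact absurd (hc ▸ hcu.mul hcu) hu

theorem isDomain_coordinateRing {k : K} (hk : k ≠ 0) {f : K[X]} (hf : Squarefree f)
    (hu : ¬ IsUnit f) : IsDomain (CoordinateRing k f) := by
  have hCk : IsUnit (C (C k⁻¹) : K[X][X]) :=
    Polynomial.isUnit_C.2 (Polynomial.isUnit_C.2 (inv_ne_zero hk).isUnit)
  have h1 : C (C k⁻¹) * (C (C k) * X ^ 2 - C f : K[X][X]) = X ^ 2 - C (C k⁻¹ * f) := by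
    rw [mul_sub, ← mul_assoc, ← C_mul, ← C_mul, ← C_mul, inv_mul_cancel₀ hk]
    simp
  have hmon : (X ^ 2 - C (C k⁻¹ * f) : K[X][X]).Monic := monic_X_pow_sub_C _ two_ne_zero
  have hdeg : (X ^ 2 - C (C k⁻¹ * f) : K[X][X]).natDegree = 2 := natDegree_X_pow_sub_C
  have hirr : Irreducible (C (C k) * X ^ 2 - C f : K[X][X]) := by
    rw [← irreducible_isUnit_mul hCk, h1,
      hmon.irreducible_iff_roots_eq_zero_of_degree_le_three hdeg.ge (by rw [hdeg]; norm_num)]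
    refine Multiset.eq_zero_of_forall_notMem fun c hc => ?_
    have hc' : c ^ 2 = C k⁻¹ * f := by
      have := isRoot_of_mem_roots hc
      simpa [IsRoot, sub_eq_zero] using this
    have hkf : f = C k * c ^ 2 := by
      rw [hc', ← mul_assoc, ← C_mul, mul_inv_cancel₀ hk, C_1, one_mul]
    have hcu : IsUnit c := hf c ⟨C k, by rw [hkf]; ring⟩
    exact hu (hkf ▸ (Polynomial.isUnit_C.2 hk.isUnit).mul (hcu.pow 2))
  exact AdjoinRoot.isDomain_of_prime hirr.prime

theorem exists_eq_of_add_of_mul_root {k : K} (hk : k ≠ 0) (f : K[X]) (z : CoordinateRing k f) :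
    ∃ a b : K[X], z = AdjoinRoot.of _ a + AdjoinRoot.of _ b * AdjoinRoot.root _ := by
  have hsq : (AdjoinRoot.root (C (C k) * X ^ 2 - C f : K[X][X])) ^ 2
      = AdjoinRoot.of _ (C k⁻¹ * f) := by
    have h := AdjoinRoot.eval₂_root (C (C k) * X ^ 2 - C f : K[X][X])
    rw [eval₂_sub, eval₂_mul, eval₂_C, eval₂_pow, eval₂_X, eval₂_C, sub_eq_zero] at h
    rw [map_mul, ← h, ← mul_assoc, ← map_mul, ← C_mul, inv_mul_cancel₀ hk]
    simp
  induction z using AdjoinRoot.induction_on with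
  | ih p =>
    induction p using Polynomial.induction_on' with
    | add p q hp hq =>
      obtain ⟨a, b, h⟩ := hp
      obtain ⟨a', b', h'⟩ := hq
      refine ⟨a + a', b + b', ?_⟩
      rw [map_add, h, h', map_add, map_add]
      ring
    | monomial n p =>
      induction n with
      | zero =>
        refine ⟨p, 0, ?_⟩
        rw [monomial_zero_left, AdjoinRoot.mk_C]
        simp
      | succ n ih =>
        obtain ⟨a, b, h⟩ := ih
        refine ⟨C k⁻¹ * f * b, a, ?_⟩
        rw [← monomial_mul_X, map_mul, h, AdjoinRoot.mk_X, map_mul _ (C k⁻¹ * f), ← hsq]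
        ring

/-- `F` is the function field of `y² = f(x)` over `K`, with the given coordinate functions. -/
structure IsPresentation {F : Type*} [Field F] [Algebra K F] (f : K[X]) (x y : F) : Prop where
  transcendental : Transcendental K x
  sq : y ^ 2 = aeval x f
  gen : ∀ z : F, ∃ a b c : K[X], c ≠ 0 ∧ aeval x c * z = aeval x a + aeval x b * y

variable {F : Type*} [Field F] [Algebra K F]

theorem _root_.Transcendental.aeval_ne_zero {x : F} (hx : Transcendental K x) {c : K[X]}
    (hc : c ≠ 0) : aeval x c ≠ 0 :=
  fun h => hc (transcendental_iff.1 hx c h)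

theorem eq_zero_of_aeval_add_aeval_mul {f : K[X]} (hf : Squarefree f) (hu : ¬ IsUnit f) {x y : F}
    (hx : Transcendental K x) (hy : y ^ 2 = aeval x f) {a b : K[X]}
    (h : aeval x a + aeval x b * y = 0) : a = 0 ∧ b = 0 := by
  refine eq_zero_of_sq_eq_sq_mul hf hu (transcendental_iff_injective.1 hx ?_)
  rw [map_pow, map_mul, map_pow, ← hy, eq_neg_of_add_eq_zero_left h]
  ring

/-- Denominators are rationalised with the conjugate c - d y; the norm c² - d² f is nonzero because
f is not a square. -/
theorem IsPresentation.of_surjective {f : K[X]} {x y : F} (hx : Transcendental K x)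
    (hy : y ^ 2 = aeval x f) (hf : Squarefree f) (hu : ¬ IsUnit f)
    (h : ∀ z : F, ∃ a b c d : K[X], aeval x c + aeval x d * y ≠ 0 ∧
      (aeval x c + aeval x d * y) * z = aeval x a + aeval x b * y) :
    IsPresentation f x y := by
  refine ⟨hx, hy, fun z => ?_⟩
  obtain ⟨a, b, c, d, hcd, hz⟩ := h z
  refine ⟨a * c - b * d * f, b * c - a * d, c ^ 2 - d ^ 2 * f, fun h0 => ?_, ?_⟩
  · obtain ⟨rfl, rfl⟩ := eq_zero_of_sq_eq_sq_mul hf hu (sub_eq_zero.1 h0)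
    simp at hcd
  · simp only [map_sub, map_mul, map_pow, ← hy]
    linear_combination (aeval x c - aeval x d * y) * hz

/-- Dividing the equation by k turns the twist k y² = f into the monic form y² = k⁻¹ f, so twists
need no separate theory. -/
theorem exists_isPresentation_functionField {k : K} (hk : k ≠ 0) {f : K[X]}
    (hf : Squarefree f) (hu : ¬ IsUnit f) [IsDomain (CoordinateRing k f)] :
    ∃ x y : FunctionField k f, IsPresentation (C k⁻¹ * f) x y := by
  have hun : IsUnit (C k⁻¹ : K[X]) := Polynomial.isUnit_C.2 (inv_ne_zero hk).isUnit
  have hf' : Squarefree (C k⁻¹ * f) := by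
    intro z hz
    exact hf z (hun.dvd_mul_left.1 hz)
  have hu' : ¬ IsUnit (C k⁻¹ * f) := fun h => hu (isUnit_of_mul_isUnit_right h)
  set P : K[X][X] := C (C k) * X ^ 2 - C f with hP
  let φ : CoordinateRing k f →ₐ[K] FunctionField k f := Algebra.algHom K _ _
  have hφ : Function.Injective φ := IsFractionRing.injective (CoordinateRing k f) _
  set x : FunctionField k f := φ (AdjoinRoot.of P X) with hx
  set y : FunctionField k f := φ (AdjoinRoot.root P) with hy
  have hof : ∀ a : K[X], aeval x a = φ (AdjoinRoot.of P a) := by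
    intro a
    have : (AdjoinRoot.of P a) = aeval (AdjoinRoot.of P X) a := by
      have h := Polynomial.aeval_algHom_apply (AdjoinRoot.ofAlgHom K P) X a
      rw [aeval_X_left_apply] at h
      exact h.symm
    rw [this, hx, Polynomial.aeval_algHom_apply]
  have hdeg : P.degree ≠ 0 := by
    have h2 : P.degree = 2 := by
      rw [hP, sub_eq_add_neg, ← C_neg]
      have := Polynomial.degree_quadratic (a := (C k : K[X])) (b := 0) (c := -f) (C_ne_zero.2 hk)
      simpa using this
    rw [h2]
    norm_num
  have hofinj : Function.Injective (AdjoinRoot.of P) :=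
    AdjoinRoot.of.injective_of_degree_ne_zero hdeg
  have htr : Transcendental K x := by
    rw [transcendental_iff_injective]
    intro a b hab
    rw [hof, hof] at hab
    exact hofinj (hφ hab)
  have hsq : y ^ 2 = aeval x (C k⁻¹ * f) := by
    have h := AdjoinRoot.eval₂_root P
    rw [hP, eval₂_sub, eval₂_mul, eval₂_C, eval₂_pow, eval₂_X, eval₂_C, sub_eq_zero] at h
    rw [hof, hy, ← map_pow, map_mul (AdjoinRoot.of P), ← h, ← mul_assoc, ← map_mul, ← C_mul,
      inv_mul_cancel₀ hk, C_1, map_one, one_mul]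
  have hlin : ∀ a b : K[X], φ (AdjoinRoot.of P a + AdjoinRoot.of P b * AdjoinRoot.root P) =
      aeval x a + aeval x b * y := by
    intro a b
    rw [map_add, map_mul, hof, hof]
  refine ⟨x, y, .of_surjective htr hsq hf' hu' fun z => ?_⟩
  obtain ⟨n, d, hd, rfl⟩ := IsFractionRing.div_surjective (A := CoordinateRing k f) z
  obtain ⟨a, b, hab⟩ := exists_eq_of_add_of_mul_root hk f n
  obtain ⟨a', b', hab'⟩ := exists_eq_of_add_of_mul_root hk f d
  have hd0 : φ d ≠ 0 := (map_ne_zero_iff φ hφ).2 (nonZeroDivisors.ne_zero hd)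
  refine ⟨a, b, a', b', ?_, ?_⟩
  · rw [← hlin, ← hab']
    exact hd0
  · rw [← hlin, ← hlin, ← hab', ← hab]
    exact mul_div_cancel₀ _ hd0

theorem exists_algHom_coordinateRing {f : K[X]} (hf : Squarefree f) (hu : ¬ IsUnit f)
    {u v : F} (htr : Transcendental K u) (huv : v ^ 2 = aeval u f) :
    ∃ φ : CoordinateRing (1 : K) f →ₐ[K] F, Function.Injective φ ∧
      (∀ a, φ (AdjoinRoot.of _ a) = aeval u a) ∧ φ (AdjoinRoot.root _) = v := by
  have h0 : eval₂ (aeval u : K[X] →ₐ[K] F).toRingHom v (C (C 1) * X ^ 2 - C f : K[X][X]) = 0 := by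
    simp [eval₂_sub, huv]
  let φ : CoordinateRing (1 : K) f →ₐ[K] F := AdjoinRoot.liftAlgHom _ (aeval u) v h0
  have h1 : ∀ a, φ (AdjoinRoot.of _ a) = aeval u a := fun a => AdjoinRoot.lift_of h0
  have h2 : φ (AdjoinRoot.root _) = v := AdjoinRoot.lift_root h0
  refine ⟨φ, ?_, h1, h2⟩
  rw [injective_iff_map_eq_zero]
  intro z hz
  obtain ⟨a, b, rfl⟩ := exists_eq_of_add_of_mul_root one_ne_zero f z
  rw [map_add, map_mul, h1, h1, h2] at hz
  obtain ⟨rfl, rfl⟩ := eq_zero_of_aeval_add_aeval_mul hf hu htr huv hz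
  simp

/-- A solution of `v² = f(u)` with `u` transcendental defines a homomorphism of function fields. -/
theorem IsPresentation.exists_algHom {f : K[X]} {x y : F} (h : IsPresentation f x y)
    (hf : Squarefree f) (hu : ¬ IsUnit f) {E : Type*} [Field E] [Algebra K E] {u v : E}
    (htr : Transcendental K u) (huv : v ^ 2 = aeval u f) :
    ∃ φ : F →ₐ[K] E, φ x = u ∧ φ y = v := by
  obtain ⟨ι, hι, hι1, hι2⟩ := exists_algHom_coordinateRing hf hu h.transcendental h.sq
  obtain ⟨ψ, hψ, hψ1, hψ2⟩ := exists_algHom_coordinateRing hf hu htr huv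
  have := isDomain_coordinateRing one_ne_zero hf hu
  let _ := ι.toAlgebra
  have : IsScalarTower K (CoordinateRing (1 : K) f) F :=
    .of_algebraMap_eq fun a => (ι.commutes a).symm
  have hmap : ∀ z, algebraMap (CoordinateRing (1 : K) f) F z = ι z := fun z => rfl
  have : FaithfulSMul (CoordinateRing (1 : K) f) F :=
    (faithfulSMul_iff_algebraMap_injective _ _).2 hι
  have : IsFractionRing (CoordinateRing (1 : K) f) F := by
    refine IsFractionRing.of_field _ _ fun z => ?_
    obtain ⟨a, b, c, hc, hz⟩ := h.gen z
    refine ⟨AdjoinRoot.of _ a + AdjoinRoot.of _ b * AdjoinRoot.root _, AdjoinRoot.of _ c, ?_⟩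
    rw [hmap, hmap, map_add, map_mul, hι1, hι1, hι1, hι2, ← hz,
      mul_div_cancel_left₀ _ (h.transcendental.aeval_ne_zero hc)]
  refine ⟨IsFractionRing.liftAlgHom hψ, ?_, ?_⟩
  · rw [IsFractionRing.liftAlgHom_apply, ← aeval_X (R := K) x, ← hι1, ← hmap]
    exact (IsFractionRing.lift_algebraMap hψ _).trans (by simp [hψ1])
  · rw [IsFractionRing.liftAlgHom_apply, ← hι2, ← hmap]
    exact (IsFractionRing.lift_algebraMap hψ _).trans hψ2

theorem IsPresentation.algHom_ext {f : K[X]} {x y : F} (h : IsPresentation f x y)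
    {E : Type*} [Field E] [Algebra K E] {φ ψ : F →ₐ[K] E} (hx : φ x = ψ x) (hy : φ y = ψ y) :
    φ = ψ := by
  ext z
  obtain ⟨a, b, c, hc, hz⟩ := h.gen z
  have h1 := congrArg φ hz
  have h2 := congrArg ψ hz
  simp only [map_mul, map_add, ← Polynomial.aeval_algHom_apply, hx, hy] at h1 h2
  refine mul_left_cancel₀ (a := aeval (ψ x) c) ?_ (h1.trans h2.symm)
  rw [Polynomial.aeval_algHom_apply]
  exact (map_ne_zero ψ).2 (h.transcendental.aeval_ne_zero hc)

end Presentation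

/-! ### Regular differentials, valuation rings and the integral closure of L[x] -/

theorem dvd_of_sq_dvd_sq_mul {K : Type*} [Field K] {f b c : K[X]} (hf : Squarefree f) (hc : c ≠ 0)
    (h : c ^ 2 ∣ b ^ 2 * f) : c ∣ b := by
  obtain ⟨c', b', g, hrel, rfl, rfl⟩ := UniqueFactorizationMonoid.exists_reduced_factors c hc b
  have hg : g ≠ 0 := left_ne_zero_of_mul hc
  rw [mul_pow, mul_pow, mul_assoc, mul_dvd_mul_iff_left (pow_ne_zero 2 hg)] at h
  have h1 : c' ^ 2 ∣ f := (hrel.isCoprime.pow (m := 2) (n := 2)).dvd_of_dvd_mul_left h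
  exact mul_dvd_mul_left g ((hf c' (by rwa [← sq])).dvd)

section Differential

variable {L F : Type*} [Field L] [Field F] [Algebra L F]

theorem aeval_mem_valuationSubring {O : ValuationSubring F} (hL : ∀ a : L, algebraMap L F a ∈ O)
    {t : F} (ht : t ∈ O) (g : L[X]) : aeval t g ∈ O := by
  let S : Subalgebra L F := { O.toSubring with algebraMap_mem' := hL }
  exact Algebra.adjoin_le (S := S) (Set.singleton_subset_iff.2 ht)
    (aeval_mem_adjoin_singleton L t)

/-- A differential `dt / w` with `w² = g(t)` and `g` separable is regular where `t` is. -/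
theorem derivation_div_mem_valuationSubring {O : ValuationSubring F}
    (hL : ∀ a : L, algebraMap L F a ∈ O) {δ : Derivation L F F} (hδ : ∀ z ∈ O, δ z ∈ O)
    {g : L[X]} (hg : g.Separable) {t w : F} (ht : t ∈ O) (hw : w ^ 2 = aeval t g) (hw0 : w ≠ 0) :
    δ t / w ∈ O := by
  obtain ⟨a, b, hab⟩ := hg
  have hmem := fun p : L[X] => aeval_mem_valuationSubring hL ht p
  have hwO : w ∈ O := by
    rcases O.mem_or_inv_mem w with h | h
    · exact h
    · have : w = aeval t g * w⁻¹ := by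
        rw [← hw]
        field_simp
      rw [this]
      exact O.mul_mem _ _ (hmem g) h
  have h1 : aeval t a * w ^ 2 + aeval t b * aeval t (derivative g) = 1 := by
    rw [hw, ← map_mul, ← map_mul, ← map_add, hab, map_one]
  have h2 : 2 * w * δ w = aeval t (derivative g) * δ t := by
    have := congrArg δ hw
    rw [Derivation.leibniz_pow, Derivation.map_aeval] at this
    simpa [mul_assoc] using this
  -- The Bézout relation a g + b g' = 1, with g = w² and g' δt = 2w δw, removes w from the
  -- denominator.
  have h3 : δ t / w = aeval t a * w * δ t + aeval t b * (δ w + δ w) := by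
    rw [div_eq_iff hw0]
    linear_combination (-δ t) * h1 - aeval t b * h2
  rw [h3]
  exact O.add_mem _ _ (O.mul_mem _ _ (O.mul_mem _ _ (hmem a) hwO) (hδ _ ht))
    (O.mul_mem _ _ (hmem b) (O.add_mem _ _ (hδ _ hwO) (hδ _ hwO)))

/-- The differentials `du / v` and `u du / v` on `v² = g(u)` are regular everywhere. -/
theorem derivation_div_mem_valuationSubring_of_reverse {O : ValuationSubring F}
    (hL : ∀ a : L, algebraMap L F a ∈ O) {δ : Derivation L F F} (hδ : ∀ z ∈ O, δ z ∈ O)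
    {g g' : L[X]} (hg : g.Separable) (hg' : g'.Separable) {u v : F} (hu : u ≠ 0) (hv0 : v ≠ 0)
    (hv : v ^ 2 = aeval u g) (hv' : (v / u ^ 3) ^ 2 = aeval u⁻¹ g') :
    δ u / v ∈ O ∧ u * (δ u / v) ∈ O := by
  rcases O.mem_or_inv_mem u with h | h
  · have := derivation_div_mem_valuationSubring hL hδ hg h hv hv0
    exact ⟨this, O.mul_mem _ _ h this⟩
  -- At a pole of u the chart (u⁻¹, v/u³) is used: there d(u⁻¹)/(v/u³) = -u du/v.
  · have := derivation_div_mem_valuationSubring hL hδ hg' h hv' (by positivity)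
    rw [Derivation.leibniz_inv] at this
    have h1 : u * (δ u / v) ∈ O := by
      have h2 := O.neg_mem _ this
      convert h2 using 1
      simp only [smul_eq_mul]
      field_simp
    refine ⟨?_, h1⟩
    have h2 := O.mul_mem _ _ h h1
    rwa [inv_mul_cancel_left₀ hu] at h2

variable [Algebra L[X] F] [IsScalarTower L L[X] F]

theorem algebraMap_eq_aeval_algebraMap_X (a : L[X]) :
    algebraMap L[X] F a = aeval (algebraMap L[X] F X) a := by
  rw [Polynomial.aeval_algebraMap_apply, aeval_X_left_apply]

variable [FaithfulSMul L[X] F]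

attribute [local instance] FractionRing.liftAlgebra

theorem IsPresentation.finiteDimensional {f : L[X]} {y : F}
    (h : IsPresentation f (algebraMap L[X] F X) y) :
    FiniteDimensional (FractionRing L[X]) F := by
  classical
  refine ⟨⟨({1, y} : Finset F), ?_⟩⟩
  rw [eq_top_iff]
  rintro z -
  obtain ⟨a, b, c, hc, hz⟩ := h.gen z
  simp only [← algebraMap_eq_aeval_algebraMap_X] at hz
  have hc' : algebraMap L[X] F c ≠ 0 :=
    (map_ne_zero_iff _ (FaithfulSMul.algebraMap_injective _ _)).2 hc
  rw [Finset.coe_pair, Submodule.mem_span_pair]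
  refine ⟨algebraMap _ _ a / algebraMap _ _ c, algebraMap _ _ b / algebraMap _ _ c, ?_⟩
  simp only [Algebra.smul_def, map_div₀, ← IsScalarTower.algebraMap_apply]
  field_simp
  linear_combination -hz

/-- In characteristic zero F is separable over L(X), hence formally étale over L[X]; so Ω of F is
the base change of Ω of L[X], and d/dX extends. -/
theorem exists_derivation [CharZero L] [FiniteDimensional (FractionRing L[X]) F] :
    ∃ D : Derivation L F F, D (algebraMap L[X] F X) = 1 := by
  have : Algebra.FormallyEtale (FractionRing L[X]) F := Algebra.FormallyEtale.of_isSeparable _ _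
  have : Algebra.FormallyEtale L[X] (FractionRing L[X]) :=
    Algebra.FormallyEtale.of_isLocalization (nonZeroDivisors L[X])
  have : Algebra.FormallyEtale L[X] F := Algebra.FormallyEtale.comp _ (FractionRing L[X]) _
  let e := KaehlerDifferential.tensorKaehlerEquivOfFormallyEtale L L[X] F
  let g : Ω[L[X]⁄L] →ₗ[L[X]] F := (Polynomial.mkDerivation L (1 : F)).liftKaehlerDifferential
  refine ⟨((LinearMap.liftBaseChange F g).comp e.symm.toLinearMap).compDer
    (KaehlerDifferential.D L F), ?_⟩
  simp [e, g, KaehlerDifferential.tensorKaehlerEquivOfFormallyEtale_symm_D_algebraMap]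

/-- The affine curve is normal. For integral z = (a + b y)/c, the trace 2a/c under y ↦ -y is
integral, hence a polynomial. Then (b/c)² f is integral too, and square-freeness of f gives c ∣ b.
-/
theorem IsPresentation.exists_eq_of_isIntegral [CharZero L] {f : L[X]} {y : F} (hf : Squarefree f)
    (hu : ¬ IsUnit f) (h : IsPresentation f (algebraMap L[X] F X) y) {z : F}
    (hz : IsIntegral L[X] z) : ∃ a b, z = algebraMap L[X] F a + algebraMap L[X] F b * y := by
  have hsq := h.sq
  obtain ⟨ι, hιx, hιy⟩ := h.exists_algHom hf hu (v := -y) h.transcendental (by rw [neg_sq, h.sq])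
  obtain ⟨a, b, c, hc, habc⟩ := h.gen z
  simp only [← algebraMap_eq_aeval_algebraMap_X] at hsq habc
  have hc' : algebraMap L[X] F c ≠ 0 :=
    (map_ne_zero_iff _ (FaithfulSMul.algebraMap_injective _ _)).2 hc
  have hιa : ∀ a : L[X], ι (algebraMap L[X] F a) = algebraMap L[X] F a := fun a => by
    rw [algebraMap_eq_aeval_algebraMap_X, ← Polynomial.aeval_algHom_apply, hιx]
  let ι' : F →ₐ[L[X]] F := { ι with commutes' := hιa }
  have hιz : IsIntegral L[X] (ι z) := hz.map ι'
  have habc' : algebraMap L[X] F c * ι z = algebraMap L[X] F a - algebraMap L[X] F b * y := by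
    have := congrArg ι habc
    rwa [map_mul, map_add, map_mul, hιa, hιa, hιa, hιy, mul_neg, ← sub_eq_add_neg] at this
  have hint : ∀ p q : L[X], ∀ w : F, q ≠ 0 → IsIntegral L[X] w →
      algebraMap L[X] F q * w = algebraMap L[X] F p → q ∣ p := by
    intro p q w hq hw hpq
    have hw' : algebraMap (FractionRing L[X]) F (algebraMap _ _ p / algebraMap _ _ q) = w := by
      rw [map_div₀, ← IsScalarTower.algebraMap_apply, ← IsScalarTower.algebraMap_apply, ← hpq,
        mul_div_cancel_left₀]
      exact (map_ne_zero_iff _ (FaithfulSMul.algebraMap_injective _ _)).2 hq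
    rw [← hw', isIntegral_algebraMap_iff (algebraMap (FractionRing L[X]) F).injective,
      IsIntegrallyClosed.isIntegral_iff] at hw
    obtain ⟨r, hr⟩ := hw
    refine ⟨r, IsFractionRing.injective L[X] (FractionRing L[X]) ?_⟩
    rw [map_mul, hr, mul_div_cancel₀]
    exact (map_ne_zero_iff _ (IsFractionRing.injective L[X] (FractionRing L[X]))).2 hq
  obtain ⟨a', ha'⟩ : c ∣ C 2 * a := by
    refine hint _ _ (z + ι z) hc (hz.add hιz) ?_
    rw [mul_add, habc, habc', map_mul, show algebraMap L[X] F (C 2) = 2 by rw [C_ofNat, map_ofNat]]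
    ring
  have ha : a = c * (C 2⁻¹ * a') := by
    rw [mul_left_comm, ← ha', ← mul_assoc, ← C_mul, inv_mul_cancel₀ two_ne_zero, C_1, one_mul]
  obtain ⟨b', rfl⟩ : c ∣ b := by
    refine dvd_of_sq_dvd_sq_mul hf hc (hint _ _ ((z - algebraMap _ _ (C 2⁻¹ * a')) ^ 2)
      (pow_ne_zero 2 hc) ((hz.sub isIntegral_algebraMap).pow 2) ?_)
    rw [map_pow, ← mul_pow, mul_sub, habc, ← map_mul, ← ha, add_sub_cancel_left, mul_pow, hsq,
      map_mul, map_pow]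
  refine ⟨C 2⁻¹ * a', b', mul_left_cancel₀ hc' ?_⟩
  rw [habc, ha]
  simp only [map_mul]
  ring

/-- A function that lies in all localizations of the affine coordinate ring is a polynomial in
the coordinates. -/
theorem IsPresentation.exists_eq_of_forall_valuationSubring [CharZero L] {f : L[X]} {x y : F}
    (hx : x = algebraMap L[X] F X) (hf : Squarefree f) (hu : ¬ IsUnit f)
    (h : IsPresentation f x y) {δ : Derivation L F F} (hδx : δ x = y)
    (hδy : δ y = aeval x (C (2 : L)⁻¹ * derivative f)) {z : F}
    (hz : ∀ O : ValuationSubring F, (∀ a : L, algebraMap L F a ∈ O) → (∀ w ∈ O, δ w ∈ O) → z ∈ O) :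
    ∃ a b : L[X], z = aeval x a + aeval x b * y := by
  subst hx
  have := h.finiteDimensional
  let R := integralClosure L[X] F
  have hRF : IsFractionRing R F :=
    integralClosure.isFractionRing_of_finite_extension (FractionRing L[X]) F
  have hD : IsDedekindDomain R := inferInstance
  have hlin : ∀ r : R, ∃ a b : L[X], (r : F) = aeval (algebraMap L[X] F X) a +
      aeval (algebraMap L[X] F X) b * y := fun r => by
    simp only [← algebraMap_eq_aeval_algebraMap_X]
    exact h.exists_eq_of_isIntegral hf hu r.2
  have hy : IsIntegral L[X] y := by
    refine IsIntegral.of_pow two_pos ?_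
    rw [h.sq, ← algebraMap_eq_aeval_algebraMap_X]
    exact isIntegral_algebraMap
  -- δ = y d/dx is dual to dx/y; it preserves R = L[x, y] since δx and δy are polynomials, and its
  -- localizations by the quotient rule. So these localizations are among the rings tested by `hz`.
  have hδR : ∀ r : R, δ r ∈ R := by
    intro r
    obtain ⟨a, b, hr⟩ := hlin r
    have hpoly : ∀ p : L[X], aeval (algebraMap L[X] F X) p ∈ R := fun p => by
      rw [← algebraMap_eq_aeval_algebraMap_X]
      exact R.algebraMap_mem p
    rw [hr, map_add, Derivation.leibniz, Derivation.map_aeval, Derivation.map_aeval, hδx, hδy]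
    simp only [smul_eq_mul]
    exact R.add_mem (R.mul_mem (hpoly _) hy) (R.add_mem (R.mul_mem (hpoly _) (hpoly _))
      (R.mul_mem hy (R.mul_mem (hpoly _) hy)))
  have hmem : z ∈ (algebraMap R F).range := by
    -- A Dedekind domain is the intersection of its localizations at height-one primes.
    refine IsDedekindDomain.HeightOneSpectrum.mem_integers_of_valuation_le_one F z fun v => ?_
    rw [← Valuation.mem_valuationSubring_iff,
      ← IsDedekindDomain.HeightOneSpectrum.valuationSubringAtPrime_eq_valuationSubring]
    have hR : ∀ r : R, (r : F) ∈
        IsDedekindDomain.HeightOneSpectrum.valuationSubringAtPrime F v := fun r =>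
      (algebraMap R (IsDedekindDomain.HeightOneSpectrum.valuationSubringAtPrime F v) r).2
    refine hz _ (fun a => ?_) ?_
    · rw [IsScalarTower.algebraMap_apply L L[X] F]
      exact hR (algebraMap L[X] R _)
    · rintro _ ⟨r, s, hs, rfl⟩
      have hsinv : (s : F)⁻¹ ∈ IsDedekindDomain.HeightOneSpectrum.valuationSubringAtPrime F v :=
        ⟨1, s, hs, by simp⟩
      change δ ((r : F) * (s : F)⁻¹) ∈ _
      rw [Derivation.leibniz, Derivation.leibniz_inv]
      simp only [smul_eq_mul]
      exact add_mem (mul_mem (hR r) (mul_mem (neg_mem (pow_mem hsinv 2)) (hR ⟨_, hδR s⟩)))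
        (mul_mem hsinv (hR ⟨_, hδR r⟩))
  obtain ⟨r, rfl⟩ := hmem
  exact hlin r

end Differential

/-! ### Ratios of regular differentials are polynomial on an affine chart -/

section Regular

variable {L F : Type*} [Field L] [CharZero L] [Field F] [Algebra L F]

attribute [local instance] FractionRing.liftAlgebra

/-- y D u / v is the ratio of du/v to dx/y, that is δu / v for δ = y D. It lies in every valuation
ring over L stable under δ, which characterises polynomials in x and y. -/
theorem exists_regular {f : L[X]} {x y : F} (h : IsPresentation f x y) (hf : f.Separable)
    (hu : ¬ IsUnit f) {D : Derivation L F F} (hD : D x = 1) {g g' : L[X]} (hg : g.Separable)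
    (hg' : g'.Separable) {u v : F} (hu0 : u ≠ 0) (hv0 : v ≠ 0) (hv : v ^ 2 = aeval u g)
    (hv' : (v / u ^ 3) ^ 2 = aeval u⁻¹ g') :
    (∃ a b : L[X], y * D u / v = aeval x a + aeval x b * y) ∧
      ∃ a b : L[X], u * (y * D u / v) = aeval x a + aeval x b * y := by
  let _ : Algebra L[X] F := (aeval x : L[X] →ₐ[L] F).toAlgebra
  have hst : IsScalarTower L L[X] F := .of_algebraMap_eq fun a => ((aeval x).commutes a).symm
  have hfs : FaithfulSMul L[X] F := (faithfulSMul_iff_algebraMap_injective _ _).2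
    (transcendental_iff_injective.1 h.transcendental)
  have hx : x = algebraMap L[X] F X := (aeval_X x).symm
  have hy0 : y ≠ 0 := by
    intro hy
    have := h.sq
    rw [hy, zero_pow two_ne_zero, eq_comm] at this
    exact hf.ne_zero (transcendental_iff.1 h.transcendental _ this)
  have hDy : (y • D) y = aeval x (C (2 : L)⁻¹ * derivative f) := by
    have h1 := congrArg D h.sq
    rw [Derivation.leibniz_pow, Derivation.map_aeval, hD] at h1
    rw [map_mul, aeval_C, map_inv₀, map_ofNat]
    have h2 : (2 : F) ≠ 0 := by
      have := charZero_of_injective_algebraMap (algebraMap L F).injective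
      exact two_ne_zero
    simp at h1 ⊢
    field_simp
    linear_combination h1
  have key := fun z => h.exists_eq_of_forall_valuationSubring hx hf.squarefree hu
    (δ := y • D) (by simp [hD]) hDy (z := z)
  have hloc := fun (O : ValuationSubring F) (hL : ∀ a : L, algebraMap L F a ∈ O)
    (hδ : ∀ w ∈ O, (y • D) w ∈ O) =>
    derivation_div_mem_valuationSubring_of_reverse hL hδ hg hg' hu0 hv0 hv hv'
  exact ⟨key _ fun O h1 h2 => (hloc O h1 h2).1, key _ fun O h1 h2 => (hloc O h1 h2).2⟩

theorem exists_derivation_of_isPresentation {f : L[X]} {x y : F} (h : IsPresentation f x y) :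
    ∃ D : Derivation L F F, D x = 1 := by
  let _ : Algebra L[X] F := (aeval x : L[X] →ₐ[L] F).toAlgebra
  have hst : IsScalarTower L L[X] F := .of_algebraMap_eq fun a => ((aeval x).commutes a).symm
  have hfs : FaithfulSMul L[X] F := (faithfulSMul_iff_algebraMap_injective _ _).2
    (transcendental_iff_injective.1 h.transcendental)
  have hx : x = algebraMap L[X] F X := (aeval_X x).symm
  rw [hx] at h ⊢
  have := h.finiteDimensional
  exact exists_derivation

end Regular

/-! ### The chart at infinity, and isomorphisms as fractional linear transformations -/

section Moebius

variable {L F : Type*} [Field L] [Field F] [Algebra L F]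

theorem aeval_eq_aeval_inv_reverse {x : F} (hx : x ≠ 0) (a : L[X]) :
    aeval x a = aeval x⁻¹ a.reverse * x ^ a.natDegree := by
  let _ := invertibleOfNonzero hx
  have := eval₂_reverse_mul_pow (algebraMap L F) x a
  rw [invOf_eq_inv] at this
  exact this.symm

theorem IsPresentation.ne_zero {f : L[X]} {x y : F} (h : IsPresentation f x y) : x ≠ 0 := by
  have := h.transcendental.aeval_ne_zero X_ne_zero
  rwa [aeval_X] at this

theorem IsPresentation.ne_zero_right {f : L[X]} {x y : F} (h : IsPresentation f x y)
    (hf : f ≠ 0) : y ≠ 0 := by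
  intro hy
  apply h.transcendental.aeval_ne_zero hf
  rw [← h.sq, hy, zero_pow two_ne_zero]

theorem div_pow_three_sq {f : L[X]} {x y : F} (hx : x ≠ 0) (hy : y ^ 2 = aeval x f)
    (hdeg : f.natDegree = 6) : (y / x ^ 3) ^ 2 = aeval x⁻¹ f.reverse := by
  rw [div_pow, hy, aeval_eq_aeval_inv_reverse hx, hdeg, ← pow_mul]
  exact mul_div_cancel_right₀ _ (pow_ne_zero _ hx)

theorem IsPresentation.inv {f : L[X]} {x y : F} (h : IsPresentation f x y)
    (hdeg : f.natDegree = 6) : IsPresentation f.reverse x⁻¹ (y / x ^ 3) := by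
  have hx := h.ne_zero
  refine ⟨fun hx' => h.transcendental ?_, div_pow_three_sq hx h.sq hdeg, fun z => ?_⟩
  · simpa using hx'.inv
  · obtain ⟨a, b, c, hc, hz⟩ := h.gen z
    -- The extra powers bring the three reversed polynomials to one common power of x; the 3 absorbs
    -- the x³ in y/x³.
    refine ⟨X ^ (b.natDegree + c.natDegree + 3) * a.reverse,
      X ^ (a.natDegree + c.natDegree) * b.reverse,
      X ^ (a.natDegree + b.natDegree + 3) * c.reverse,
      mul_ne_zero (pow_ne_zero _ X_ne_zero) (by simpa using hc), ?_⟩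
    rw [aeval_eq_aeval_inv_reverse hx a, aeval_eq_aeval_inv_reverse hx b,
      aeval_eq_aeval_inv_reverse hx c] at hz
    simp only [map_mul, map_pow, aeval_X]
    have : x ^ (a.natDegree + b.natDegree + c.natDegree + 3) ≠ 0 := pow_ne_zero _ hx
    apply mul_left_cancel₀ this
    have e1 : ∀ m n : ℕ, x ^ (m + n) * x⁻¹ ^ m = x ^ n := fun m n => by
      rw [pow_add, mul_comm (x ^ m), mul_assoc, ← mul_pow, mul_inv_cancel₀ hx, one_pow, mul_one]
    have ea := e1 (b.natDegree + c.natDegree + 3) a.natDegree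
    have eb := e1 (a.natDegree + c.natDegree) (b.natDegree + 3)
    have ec := e1 (a.natDegree + b.natDegree + 3) c.natDegree
    rw [show b.natDegree + c.natDegree + 3 + a.natDegree =
      a.natDegree + b.natDegree + c.natDegree + 3 by ring] at ea
    rw [show a.natDegree + c.natDegree + (b.natDegree + 3) =
      a.natDegree + b.natDegree + c.natDegree + 3 by ring] at eb
    rw [show a.natDegree + b.natDegree + 3 + c.natDegree =
      a.natDegree + b.natDegree + c.natDegree + 3 by ring] at ec
    have e3 : x ^ (b.natDegree + 3) * (y / x ^ 3) = x ^ b.natDegree * y := by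
      rw [pow_add]; field_simp
    linear_combination hz + (aeval x⁻¹ c.reverse) * z * ec - (aeval x⁻¹ a.reverse) * ea
      - (aeval x⁻¹ b.reverse) * (y / x ^ 3) * eb - (aeval x⁻¹ b.reverse) * e3

/-- A function that is a polynomial in the coordinates of both affine charts of the sheaf of
differentials is a polynomial in `x` of degree at most one. -/
theorem exists_linear_of_regular {f : L[X]} (hf : Squarefree f) (hu : ¬ IsUnit f) {x y : F}
    (h : IsPresentation f x y) {a b a' b' : L[X]}
    (hab : aeval x a + aeval x b * y =
      -x * (aeval x⁻¹ a' + aeval x⁻¹ b' * (y / x ^ 3))) :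
    ∃ c e : L, aeval x a + aeval x b * y = algebraMap L F c * x + algebraMap L F e := by
  have hx := h.ne_zero
  have hrev : ∀ p : L[X], aeval x⁻¹ p * x ^ p.natDegree = aeval x p.reverse := fun p => by
    have := aeval_eq_aeval_inv_reverse (inv_ne_zero hx) p
    rw [inv_inv] at this
    rw [this, mul_assoc, ← mul_pow, inv_mul_cancel₀ hx, one_pow, mul_one]
  have key : aeval x (X ^ (a'.natDegree + b'.natDegree + 2) * a +
      X ^ (b'.natDegree + 3) * a'.reverse) +
      aeval x (X ^ (a'.natDegree + b'.natDegree + 2) * b + X ^ a'.natDegree * b'.reverse) * y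
        = 0 := by
    simp only [map_add, map_mul, map_pow, aeval_X, ← hrev]
    have : x ^ (a'.natDegree + b'.natDegree + 2) * (x * (y / x ^ 3)) =
        x ^ (a'.natDegree + b'.natDegree) * y := by
      rw [pow_add]; field_simp
    linear_combination x ^ (a'.natDegree + b'.natDegree + 2) * hab - (aeval x⁻¹ b') * this
  obtain ⟨h1, h2⟩ := eq_zero_of_aeval_add_aeval_mul hf hu h.transcendental h.sq key
  -- With m = deg a' and n = deg b', a nonzero b makes the left side of degree at least m + n + 2
  -- and the right side of degree at most m + n. The same count for `a` leaves (n + 3) + m - (m + n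
  -- + 2) = 1.
  have hb : b = 0 := by
    by_contra hb
    have h3 := congrArg natDegree (eq_neg_of_add_eq_zero_left h2)
    rw [natDegree_neg, natDegree_X_pow_mul _ hb] at h3
    have h4 := natDegree_mul_le (p := X ^ a'.natDegree) (q := b'.reverse)
    rw [natDegree_X_pow] at h4
    have := reverse_natDegree_le b'
    omega
  have ha : a.natDegree ≤ 1 := by
    by_cases ha : a = 0
    · simp [ha]
    have h3 := congrArg natDegree (eq_neg_of_add_eq_zero_left h1)
    rw [natDegree_neg, natDegree_X_pow_mul _ ha] at h3
    have h4 := natDegree_mul_le (p := X ^ (b'.natDegree + 3)) (q := a'.reverse)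
    rw [natDegree_X_pow] at h4
    have := reverse_natDegree_le a'
    omega
  obtain ⟨c, e, rfl⟩ := exists_eq_X_add_C_of_natDegree_le_one ha
  refine ⟨c, e, ?_⟩
  simp [hb]

theorem IsPresentation.derivation_ne_zero [CharZero L] {g : L[X]} {u v : F}
    (h : IsPresentation g u v) (hg : g ≠ 0) {D : Derivation L F F} (hD : D ≠ 0) : D u ≠ 0 := by
  intro hu
  apply hD
  have := charZero_of_injective_algebraMap (algebraMap L F).injective
  have hv : D v = 0 := by
    have := congrArg D h.sq
    rw [Derivation.leibniz_pow, Derivation.map_aeval, hu] at this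
    simpa [h.ne_zero_right hg] using this
  ext z
  obtain ⟨a, b, c, hc, hz⟩ := h.gen z
  have := congrArg D hz
  simpa [Derivation.map_aeval, hu, hv, h.transcendental.aeval_ne_zero hc] using this

/-- The value at `(s, t)` of the binary sextic form attached to a polynomial. -/
def binarySextic {A : Type*} [CommRing A] [Algebra L A] (g : L[X]) (s t : A) : A :=
  ∑ i ∈ Finset.range 7, algebraMap L A (g.coeff i) * s ^ i * t ^ (6 - i)

theorem binarySextic_mul (g : L[X]) (hg : g.natDegree = 6) (u t : F) :
    binarySextic g (u * t) t = aeval u g * t ^ 6 := by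
  rw [binarySextic, aeval_eq_sum_range, hg, Finset.sum_mul]
  refine Finset.sum_congr rfl fun i hi => ?_
  have : i ≤ 6 := Nat.lt_succ_iff.1 (Finset.mem_range.1 hi)
  rw [Algebra.smul_def, mul_pow, ← Nat.add_sub_cancel' this, pow_add, Nat.add_sub_cancel' this]
  ring

/-- Two presentations of a function field of genus two are related by a fractional linear
transformation. -/
theorem IsPresentation.exists_moebius [CharZero L] {f g : L[X]} {x y u v : F}
    (h : IsPresentation f x y) (hf : f.Separable) (hfr : f.reverse.Separable)
    (hfd : f.natDegree = 6) (h' : IsPresentation g u v) (hg : g.Separable)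
    (hgr : g.reverse.Separable) (hgd : g.natDegree = 6) {D : Derivation L F F} (hD : D x = 1) :
    ∃ a b c e : L,
      D u * y = (algebraMap L F c * x + algebraMap L F e) * v ∧
      u * (algebraMap L F c * x + algebraMap L F e) = algebraMap L F a * x + algebraMap L F b ∧
      v * (algebraMap L F c * x + algebraMap L F e) ^ 3 = algebraMap L F (a * e - b * c) * y ∧
      algebraMap L F c * x + algebraMap L F e ≠ 0 ∧ a * e - b * c ≠ 0 ∧
      (binarySextic g (C a * X + C b) (C c * X + C e) : L[X]) = C ((a * e - b * c) ^ 2) * f := by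
  have hfu : ¬ IsUnit f := fun hu => by simp [natDegree_eq_zero_of_isUnit hu] at hfd
  have hfru : ¬ IsUnit f.reverse := fun hu => by
    have h0 := natDegree_eq_zero_of_isUnit hu
    rw [reverse_natDegree, hfd] at h0
    -- A constant reverse means that f is a multiple of X⁶, which is not square-free.
    have hX : X ^ 2 ∣ f := X_pow_dvd_iff.2 fun d hd =>
      coeff_eq_zero_of_lt_natTrailingDegree (by omega)
    exact not_isUnit_X (hf.squarefree X (pow_two (X : L[X]) ▸ hX))
  have hx := h.ne_zero
  have hu0 := h'.ne_zero
  have hy0 := h.ne_zero_right hf.ne_zero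
  have hv0 := h'.ne_zero_right hg.ne_zero
  have hvr := div_pow_three_sq hu0 h'.sq hgd
  -- -x² d/dx is differentiation with respect to 1/x.
  have hD' : (-x ^ 2 • D) x⁻¹ = 1 := by
    simp [Derivation.leibniz_inv, hD, hx]
  obtain ⟨⟨a₀, b₀, h0⟩, ⟨a₁, b₁, h1⟩⟩ := exists_regular h hf hfu hD hg hgr hu0 hv0 h'.sq hvr
  obtain ⟨⟨a₂, b₂, h2⟩, ⟨a₃, b₃, h3⟩⟩ :=
    exists_regular (h.inv hfd) hfr hfru hD' hg hgr hu0 hv0 h'.sq hvr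
  -- Passing to the other chart multiplies the ratio by -1/x; regularity there thus bounds the ratio
  -- at infinity by degree one.
  have hflip : y / x ^ 3 * (-x ^ 2 • D) u / v = - x⁻¹ * (y * D u / v) := by
    simp only [Derivation.smul_apply, smul_eq_mul]
    field_simp
  rw [hflip] at h2 h3
  obtain ⟨c, e, hce⟩ := exists_linear_of_regular hf.squarefree hfu h (a := a₀) (b := b₀)
    (a' := a₂) (b' := b₂) (by rw [← h0, ← h2]; field_simp)
  obtain ⟨a, b, hab⟩ := exists_linear_of_regular hf.squarefree hfu h (a := a₁) (b := b₁)
    (a' := a₃) (b' := b₃) (by rw [← h1, ← h3]; field_simp)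
  rw [← h0] at hce
  rw [← h1, hce] at hab
  have hDu : D u ≠ 0 := h'.derivation_ne_zero hg.ne_zero (by rintro rfl; simp at hD)
  have hce0 : algebraMap L F c * x + algebraMap L F e ≠ 0 := by
    rw [← hce]
    exact div_ne_zero (mul_ne_zero hy0 hDu) hv0
  have e1 : D u * y = (algebraMap L F c * x + algebraMap L F e) * v := by
    rw [← hce]; field_simp
  -- The derivative of a fractional linear map is its determinant over (cx + e)²; this fixes the
  -- scale of the matrix through v.
  have hdet : D u * (algebraMap L F c * x + algebraMap L F e) ^ 2 =
      algebraMap L F (a * e - b * c) := by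
    have := congrArg D hab
    simp [hD] at this
    simp only [map_sub, map_mul]
    linear_combination (algebraMap L F c * x + algebraMap L F e) * this - algebraMap L F c * hab
  have e3 : v * (algebraMap L F c * x + algebraMap L F e) ^ 3 =
      algebraMap L F (a * e - b * c) * y := by
    linear_combination y * hdet - (algebraMap L F c * x + algebraMap L F e) ^ 2 * e1
  refine ⟨a, b, c, e, e1, hab, e3, hce0, ?_, ?_⟩
  · intro h0
    rw [h0, map_zero] at hdet
    exact mul_ne_zero hDu (pow_ne_zero 2 hce0) hdet
  · apply transcendental_iff_injective.1 h.transcendental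
    have : aeval x (binarySextic g (C a * X + C b) (C c * X + C e) : L[X]) =
        binarySextic g (algebraMap L F a * x + algebraMap L F b)
          (algebraMap L F c * x + algebraMap L F e) := by
      simp [binarySextic]
    rw [this, ← hab, binarySextic_mul g hgd, ← h'.sq, map_mul, aeval_C, map_pow, ← h.sq]
    linear_combination (v * (algebraMap L F c * x + algebraMap L F e) ^ 3 +
      algebraMap L F (a * e - b * c) * y) * e3

end Moebius

/-! ### Base change of the function field along an algebraic extension -/

section BaseChange

variable {K L F E : Type*} [Field K] [Field L] [Field F] [Field E] [Algebra K L] [Algebra K F]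
  [Algebra L E]

theorem IsPresentation.map_algEquiv {f : K[X]} {x y : F} (h : IsPresentation f x y) {F' : Type*}
    [Field F'] [Algebra K F'] (φ : F ≃ₐ[K] F') : IsPresentation f (φ x) (φ y) := by
  have hφ : ∀ p : K[X], aeval (φ x) p = φ (aeval x p) := fun p =>
    Polynomial.aeval_algHom_apply φ x p
  refine ⟨?_, by rw [hφ, ← h.sq, map_pow], fun z => ?_⟩
  · rw [transcendental_iff]
    intro p hp
    rw [hφ, map_eq_zero_iff φ φ.injective] at hp
    exact transcendental_iff.1 h.transcendental p hp
  · obtain ⟨a, b, c, hc, hz⟩ := h.gen (φ.symm z)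
    refine ⟨a, b, c, hc, ?_⟩
    have := congrArg φ hz
    simpa [← hφ] using this

/-- The denominator c is taken over K, so that 1 ⊗ c(x) is a unit of the tensor product before that
is known to be a field. -/
theorem exists_aeval_mul_eq_of_tensorProduct {f : K[X]} {x y : F} (h : IsPresentation f x y)
    (z : L ⊗[K] F) : ∃ (c : K[X]) (a b : L[X]), c ≠ 0 ∧
      ((1 : L) ⊗ₜ[K] aeval x c) * z =
        aeval ((1 : L) ⊗ₜ[K] x) a + aeval ((1 : L) ⊗ₜ[K] x) b * ((1 : L) ⊗ₜ[K] y) := by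
  have hmap : ∀ p : K[X], aeval ((1 : L) ⊗ₜ[K] x) (p.map (algebraMap K L)) =
      (1 : L) ⊗ₜ[K] aeval x p := fun p => by
    rw [aeval_map_algebraMap]
    exact Polynomial.aeval_algHom_apply (Algebra.TensorProduct.includeRight : F →ₐ[K] L ⊗[K] F) x p
  induction z using TensorProduct.induction_on with
  | zero => exact ⟨1, 0, 0, one_ne_zero, by simp⟩
  | tmul l z =>
    obtain ⟨a, b, c, hc, hz⟩ := h.gen z
    refine ⟨c, C l * a.map (algebraMap K L), C l * b.map (algebraMap K L), hc, ?_⟩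
    rw [Algebra.TensorProduct.tmul_mul_tmul, hz, map_mul, map_mul, hmap, hmap, aeval_C,
      Algebra.TensorProduct.algebraMap_apply]
    simp [TensorProduct.tmul_add]
  | add z z' h1 h2 =>
    obtain ⟨c, a, b, hc, hz⟩ := h1
    obtain ⟨c', a', b', hc', hz'⟩ := h2
    refine ⟨c * c', c'.map (algebraMap K L) * a + c.map (algebraMap K L) * a',
      c'.map (algebraMap K L) * b + c.map (algebraMap K L) * b', mul_ne_zero hc hc', ?_⟩
    have hm : ((1 : L) ⊗ₜ[K] aeval x (c * c')) =
        ((1 : L) ⊗ₜ[K] aeval x c) * ((1 : L) ⊗ₜ[K] aeval x c') := by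
      rw [Algebra.TensorProduct.tmul_mul_tmul, map_mul, one_mul]
    rw [hm]
    simp only [map_add, map_mul, hmap]
    linear_combination ((1 : L) ⊗ₜ[K] aeval x c') * hz + ((1 : L) ⊗ₜ[K] aeval x c) * hz'

/-- The function field of the base change of `y² = f(x)` along an algebraic extension. -/
theorem exists_baseChange_algEquiv [Algebra.IsAlgebraic K L] {f : K[X]} (hf : Squarefree f)
    (hu : ¬ IsUnit f) {x y : F} (h : IsPresentation f x y)
    (hfL : Squarefree (f.map (algebraMap K L))) {x' y' : E}
    (h' : IsPresentation (f.map (algebraMap K L)) x' y') :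
    ∃ φ : L ⊗[K] F ≃ₐ[L] E, φ (1 ⊗ₜ x) = x' ∧ φ (1 ⊗ₜ y) = y' := by
  have huL : ¬ IsUnit (f.map (algebraMap K L)) := by rwa [isUnit_map]
  let _ : Algebra K E := Algebra.compHom E (algebraMap K L)
  have : IsScalarTower K L E := .of_algebraMap_eq fun _ => rfl
  have htr : Transcendental K x' := fun hx =>
    h'.transcendental (hx.extendScalars (algebraMap K L).injective)
  obtain ⟨j, hjx, hjy⟩ := h.exists_algHom hf hu htr (v := y')
    (by rw [h'.sq, aeval_map_algebraMap])
  let Φ : L ⊗[K] F →ₐ[L] E := Algebra.TensorProduct.lift (Algebra.ofId L E) j fun _ _ => .all _ _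
  have hΦ : ∀ l z, Φ (l ⊗ₜ z) = algebraMap L E l * j z := fun l z => by
    simp [Φ, Algebra.ofId_apply]
  have hΦ1 : ∀ z, Φ (1 ⊗ₜ z) = j z := fun z => by rw [hΦ, map_one, one_mul]
  have hlin : ∀ a b : L[X], Φ (aeval ((1 : L) ⊗ₜ[K] x) a + aeval ((1 : L) ⊗ₜ[K] x) b *
      ((1 : L) ⊗ₜ[K] y)) = aeval x' a + aeval x' b * y' := fun a b => by
    rw [map_add, map_mul, ← Polynomial.aeval_algHom_apply, ← Polynomial.aeval_algHom_apply,
      hΦ1, hΦ1, hjx, hjy]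
  have hinv : ∀ c : K[X], c ≠ 0 →
      ((1 : L) ⊗ₜ[K] (aeval x c)⁻¹) * ((1 : L) ⊗ₜ[K] aeval x c) = 1 := fun c hc => by
    rw [Algebra.TensorProduct.tmul_mul_tmul, one_mul,
      inv_mul_cancel₀ (h.transcendental.aeval_ne_zero hc), Algebra.TensorProduct.one_def]
  have hinj : Function.Injective Φ := by
    rw [injective_iff_map_eq_zero]
    intro z hz
    obtain ⟨c, a, b, hc, hcz⟩ := exists_aeval_mul_eq_of_tensorProduct h z
    have h0 := congrArg Φ hcz
    rw [map_mul, hz, mul_zero, hlin] at h0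
    obtain ⟨rfl, rfl⟩ := eq_zero_of_aeval_add_aeval_mul hfL huL h'.transcendental h'.sq h0.symm
    rw [map_zero, zero_mul, add_zero] at hcz
    rw [← one_mul z, ← hinv c hc, mul_assoc, hcz, mul_zero]
  have hsurj : Function.Surjective Φ := by
    intro w
    obtain ⟨a, b, c, hc, hw⟩ := h'.gen w
    -- Algebraicity of L over K enters here: every denominator over L divides one over K, which is
    -- already inverted.
    obtain ⟨g, hg, c', hc'⟩ := Polynomial.exists_dvd_map_of_isAlgebraic (R := K) hc
    refine ⟨((1 : L) ⊗ₜ[K] (aeval x g)⁻¹) * (aeval ((1 : L) ⊗ₜ[K] x) (c' * a) +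
      aeval ((1 : L) ⊗ₜ[K] x) (c' * b) * ((1 : L) ⊗ₜ[K] y)), ?_⟩
    have h1 : aeval x' g = aeval x' c * aeval x' c' := by
      rw [← map_mul, ← hc', aeval_map_algebraMap]
    have h2 : aeval x' g ≠ 0 := htr.aeval_ne_zero hg
    rw [map_mul, hlin, hΦ1, map_inv₀, ← Polynomial.aeval_algHom_apply, hjx, map_mul, map_mul]
    rw [inv_mul_eq_iff_eq_mul₀ h2, h1]
    linear_combination (-aeval x' c') * hw
  have hbij : Function.Bijective Φ := ⟨hinj, hsurj⟩
  exact ⟨AlgEquiv.ofBijective Φ hbij, (hΦ1 x).trans hjx, (hΦ1 y).trans hjy⟩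

end BaseChange

/-! ### Automorphisms and their matrices -/

section Automorphism

variable {L F : Type*} [Field L] [Field F] [Algebra L F]

/-- A matrix that preserves the binary sextic form, up to the square of its determinant, defines
an automorphism of the curve. -/
theorem IsPresentation.exists_algEquiv_of_binarySextic {f : L[X]} {x y : F}
    (h : IsPresentation f x y) (hf : Squarefree f) (hfd : f.natDegree = 6) {a b c e : L}
    (hdet : a * e - b * c ≠ 0)
    (hM : (binarySextic f (C a * X + C b) (C c * X + C e) : L[X]) =
      C ((a * e - b * c) ^ 2) * f) :
    ∃ φ : F ≃ₐ[L] F,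
      φ x * (algebraMap L F c * x + algebraMap L F e) = algebraMap L F a * x + algebraMap L F b ∧
      φ y * (algebraMap L F c * x + algebraMap L F e) ^ 3 =
        algebraMap L F (a * e - b * c) * y := by
  have hfu : ¬ IsUnit f := fun hu => by simp [natDegree_eq_zero_of_isUnit hu] at hfd
  have hdet' : algebraMap L F (a * e - b * c) ≠ 0 :=
    (map_ne_zero_iff _ (algebraMap L F).injective).2 hdet
  set w := algebraMap L F c * x + algebraMap L F e with hw
  have hw0 : w ≠ 0 := by
    have h0 : (C c * X + C e : L[X]) ≠ 0 := by
      intro h0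
      have h1 := congrArg (coeff · 1) h0
      have h2 := congrArg (coeff · 0) h0
      simp at h1 h2
      simp [h1, h2] at hdet
    have := h.transcendental.aeval_ne_zero h0
    simpa using this
  set u := (algebraMap L F a * x + algebraMap L F b) / w with hu
  have huw : u * w = algebraMap L F a * x + algebraMap L F b := div_mul_cancel₀ _ hw0
  have hxu : x * (algebraMap L F a - u * algebraMap L F c) =
      u * algebraMap L F e - algebraMap L F b := by
    rw [hw] at huw
    linear_combination -huw
  have hden : algebraMap L F a - u * algebraMap L F c ≠ 0 := by
    intro h0
    apply hdet'
    have h1 : w * (algebraMap L F a - u * algebraMap L F c) = algebraMap L F (a * e - b * c) := by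
      simp only [map_sub, map_mul]
      linear_combination (algebraMap L F a) * hw - (algebraMap L F c) * huw
    rw [← h1, h0, mul_zero]
  -- The inverse matrix recovers x from u; this gives transcendence of u and later surjectivity of
  -- φ.
  have hx : x = (u * algebraMap L F e - algebraMap L F b) /
      (algebraMap L F a - u * algebraMap L F c) := by
    rw [eq_div_iff hden, hxu]
  have htr : Transcendental L u := by
    intro hua
    apply h.transcendental
    rw [hx, div_eq_mul_inv]
    exact ((hua.mul (isAlgebraic_algebraMap e)).sub (isAlgebraic_algebraMap b)).mul
      ((isAlgebraic_algebraMap a).sub (hua.mul (isAlgebraic_algebraMap c))).inv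
  set v := algebraMap L F (a * e - b * c) * y / w ^ 3 with hv
  have hvw : v * w ^ 3 = algebraMap L F (a * e - b * c) * y :=
    div_mul_cancel₀ _ (pow_ne_zero 3 hw0)
  have hvu : v ^ 2 = aeval u f := by
    have h1 := congrArg (aeval x) hM
    have h2 : aeval x (binarySextic f (C a * X + C b) (C c * X + C e) : L[X]) =
        binarySextic f (u * w) w := by
      rw [huw]
      simp [binarySextic, hw]
    rw [h2, binarySextic_mul f hfd, map_mul, aeval_C, ← h.sq, map_pow, ← mul_pow, ← hvw] at h1
    refine mul_right_cancel₀ (pow_ne_zero 6 hw0) ?_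
    rw [h1]
    ring
  obtain ⟨φ, hφx, hφy⟩ := h.exists_algHom hf hfu htr hvu
  have hxr : x ∈ φ.fieldRange := by
    have hur : u ∈ φ.fieldRange := ⟨x, hφx⟩
    rw [hx]
    exact div_mem (sub_mem (mul_mem hur (algebraMap_mem _ _)) (algebraMap_mem _ _))
      (sub_mem (algebraMap_mem _ _) (mul_mem hur (algebraMap_mem _ _)))
  have hyr : y ∈ φ.fieldRange := by
    have hvr : v ∈ φ.fieldRange := ⟨y, hφy⟩
    have hwr : w ∈ φ.fieldRange :=
      add_mem (mul_mem (algebraMap_mem _ _) hxr) (algebraMap_mem _ _)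
    have : y = (algebraMap L F (a * e - b * c))⁻¹ * (v * w ^ 3) := by
      rw [hvw, inv_mul_cancel_left₀ hdet']
    rw [this]
    exact mul_mem (inv_mem (algebraMap_mem _ _)) (mul_mem hvr (pow_mem hwr 3))
  have hsurj : Function.Surjective φ := by
    intro z
    change z ∈ φ.fieldRange
    have hpr : ∀ p : L[X], aeval x p ∈ φ.fieldRange := fun p =>
      Algebra.adjoin_le (S := φ.fieldRange.toSubalgebra) (Set.singleton_subset_iff.2 hxr)
        (aeval_mem_adjoin_singleton L x)
    obtain ⟨a, b, c, hc, hz⟩ := h.gen z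
    have : z = (aeval x c)⁻¹ * (aeval x a + aeval x b * y) := by
      rw [← hz, inv_mul_cancel_left₀ (h.transcendental.aeval_ne_zero hc)]
    rw [this]
    exact mul_mem (inv_mem (hpr c)) (add_mem (hpr a) (mul_mem (hpr b) hyr))
  have hbij : Function.Bijective φ := ⟨φ.injective, hsurj⟩
  refine ⟨AlgEquiv.ofBijective φ hbij, ?_, ?_⟩
  · rw [AlgEquiv.ofBijective_apply, hφx, huw]
  · rw [AlgEquiv.ofBijective_apply, hφy, hvw]

/-- The matrix of an automorphism is determined by the automorphism, so it is fixed by every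
field automorphism of the constants that fixes the automorphism of the curve. -/
theorem IsPresentation.fixed_of_fixed [CharZero L] {f : L[X]} {x y u v : F}
    (h : IsPresentation f x y) (hf : f ≠ 0) {σ : L →+* L} {S : F →+* F}
    (hS : ∀ a, S (algebraMap L F a) = algebraMap L F (σ a)) (hSx : S x = x) (hSy : S y = y)
    {a b c e : L} (hdet : a * e - b * c ≠ 0)
    (hu : u * (algebraMap L F c * x + algebraMap L F e) = algebraMap L F a * x + algebraMap L F b)
    (hv : v * (algebraMap L F c * x + algebraMap L F e) ^ 3 = algebraMap L F (a * e - b * c) * y)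
    (hSu : S u = u) (hSv : S v = v) : σ a = a ∧ σ b = b ∧ σ c = c ∧ σ e = e := by
  obtain ⟨D, hD⟩ := exists_derivation_of_isPresentation h
  have hlin : ∀ a b c e : L, algebraMap L F a * x + algebraMap L F b =
      algebraMap L F c * x + algebraMap L F e → a = c ∧ b = e := by
    intro a b c e habce
    have : (C a * X + C b : L[X]) = C c * X + C e := by
      apply transcendental_iff_injective.1 h.transcendental
      simpa using habce
    have h1 := congrArg (coeff · 1) this
    have h2 := congrArg (coeff · 0) this
    simp at h1 h2
    exact ⟨h1, h2⟩
  have hy0 := h.ne_zero_right hf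
  -- The bottom row is D u · y / v, so u and v determine the matrix itself and not only its class up
  -- to scalars. Applying S yields the σ-conjugate matrix for the same u and v, which must coincide
  -- with the original.
  have key : ∀ a b c e : L, a * e - b * c ≠ 0 →
      u * (algebraMap L F c * x + algebraMap L F e) =
        algebraMap L F a * x + algebraMap L F b →
      v * (algebraMap L F c * x + algebraMap L F e) ^ 3 = algebraMap L F (a * e - b * c) * y →
      algebraMap L F c * x + algebraMap L F e = D u * y / v := by
    intro a b c e hdet hu hv
    have hr : algebraMap L F (a * e - b * c) * y ≠ 0 :=
      mul_ne_zero ((map_ne_zero_iff _ (algebraMap L F).injective).2 hdet) hy0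
    have hv0 : v ≠ 0 := by
      rintro rfl
      rw [zero_mul] at hv
      exact hr hv.symm
    have hw0 : algebraMap L F c * x + algebraMap L F e ≠ 0 := by
      intro hw
      rw [hw, zero_pow three_ne_zero, mul_zero] at hv
      exact hr hv.symm
    have hDu : D u * (algebraMap L F c * x + algebraMap L F e) ^ 2 =
        algebraMap L F (a * e - b * c) := by
      have := congrArg D hu
      simp [hD] at this
      simp only [map_sub, map_mul]
      linear_combination (algebraMap L F c * x + algebraMap L F e) * this - algebraMap L F c * hu
    rw [eq_div_iff hv0]
    refine mul_right_cancel₀ (pow_ne_zero 2 hw0) ?_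
    linear_combination hv - y * hDu
  have hu' := congrArg S hu
  have hv' := congrArg S hv
  simp only [map_mul, map_add, map_pow, hS, hSx, hSy, hSu, hSv] at hu' hv'
  rw [map_sub, map_mul, map_mul] at hv'
  have hdet' : σ a * σ e - σ b * σ c ≠ 0 := by
    rw [← map_mul, ← map_mul, ← map_sub]
    exact (map_ne_zero σ).2 hdet
  have h1 := key _ _ _ _ hdet' hu' hv'
  rw [← key _ _ _ _ hdet hu hv] at h1
  obtain ⟨hc, he⟩ := hlin _ _ _ _ h1
  rw [hc, he, hu] at hu'
  obtain ⟨ha, hb⟩ := hlin _ _ _ _ hu'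
  exact ⟨ha.symm, hb.symm, hc, he⟩

theorem fixed_of_fixed_matrix {x y u v : F} {σ : L →+* L} {S : F →+* F}
    (hS : ∀ a, S (algebraMap L F a) = algebraMap L F (σ a)) (hSx : S x = x) (hSy : S y = y)
    {a b c e : L} (hw : algebraMap L F c * x + algebraMap L F e ≠ 0)
    (hu : u * (algebraMap L F c * x + algebraMap L F e) = algebraMap L F a * x + algebraMap L F b)
    (hv : v * (algebraMap L F c * x + algebraMap L F e) ^ 3 = algebraMap L F (a * e - b * c) * y)
    (ha : σ a = a) (hb : σ b = b) (hc : σ c = c) (he : σ e = e) : S u = u ∧ S v = v := by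
  have hu' := congrArg S hu
  have hv' := congrArg S hv
  simp only [map_mul, map_add, map_pow, hS, hSx, hSy, map_sub, ha, hb, hc, he] at hu' hv'
  rw [map_sub, map_mul, map_mul] at hv
  exact ⟨mul_right_cancel₀ hw (hu'.trans hu.symm),
    mul_right_cancel₀ (pow_ne_zero 3 hw) (hv'.trans hv.symm)⟩

end Automorphism

/-! ### Binary sextics and separability of sums of two sixth powers -/

section Sextic

variable {L : Type*} [Field L]

theorem binarySextic_X_one {f : L[X]} (hf : f.natDegree = 6) : binarySextic f X (1 : L[X]) = f := by
  conv_rhs => rw [f.as_sum_range_C_mul_X_pow, hf]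
  simp [binarySextic]

theorem binarySextic_one_X {f : L[X]} (hf : f.natDegree = 6) :
    binarySextic f (1 : L[X]) X = f.reverse := by
  ext n
  rw [coeff_reverse, hf]
  simp only [binarySextic, Finset.sum_range_succ, Finset.sum_range_zero, one_pow, mul_one,
    algebraMap_eq, zero_add, coeff_add, coeff_C_mul, coeff_X_pow]
  by_cases hn : n ≤ 6
  · rw [revAt_le hn]
    interval_cases n <;> simp
  · rw [not_le] at hn
    have hz : f.coeff n = 0 := coeff_eq_zero_of_natDegree_lt (hf ▸ hn)
    rw [revAt_eq_self_of_lt hn, hz]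
    have : ∀ m ≤ 6, (if n = m then (1 : L) else 0) = 0 := fun m hm => if_neg (by omega)
    simp [this, show n ≠ 1 by omega, show n ≠ 0 by omega]

/-- The constant Wronskian w makes P and Q coprime, and combinations of f and f' give nonzero
multiples of P⁵ and Q⁵. -/
theorem separable_of_sum_sixth_powers [CharZero L] {f P Q : L[X]} {A B r s w : L} (hA : A ≠ 0)
    (hB : B ≠ 0) (hf : f = C A * P ^ 6 + C B * Q ^ 6) (hP : derivative P = C r)
    (hQ : derivative Q = C s) (hw : w ≠ 0) (hPQ : C r * Q - C s * P = C w) : f.Separable := by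
  have hcop : IsCoprime P Q := by
    refine ⟨-C (w⁻¹ * s), C (w⁻¹ * r), ?_⟩
    have : C w⁻¹ * C w = (1 : L[X]) := by rw [← C_mul, inv_mul_cancel₀ hw, C_1]
    rw [← this, ← hPQ, C_mul, C_mul]
    ring
  have hunit : ∀ z : L, z ≠ 0 → IsUnit (C (6 * w * z)) := fun z hz =>
    Polynomial.isUnit_C.2 (mul_ne_zero (mul_ne_zero (by norm_num) hw) hz).isUnit
  have h6 : (C (6 : L) : L[X]) = 6 := map_ofNat C 6
  have hd : derivative f = C A * 6 * P ^ 5 * C r + C B * 6 * Q ^ 5 * C s := by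
    rw [hf]
    simp only [derivative_add, derivative_mul, derivative_C, derivative_pow, hP, hQ,
      Nat.cast_ofNat, h6]
    ring
  have h1 : Q * derivative f - 6 * C s * f = C (6 * w * A) * P ^ 5 := by
    rw [hd, hf, C_mul, C_mul, ← hPQ, h6]
    ring
  have h2 : 6 * C r * f - P * derivative f = C (6 * w * B) * Q ^ 5 := by
    rw [hd, hf, C_mul, C_mul, ← hPQ, h6]
    ring
  obtain ⟨a, b, hab⟩ := ((isCoprime_mul_unit_left_left (hunit A hA) _ _).2
    ((isCoprime_mul_unit_left_right (hunit B hB) _ _).2 (hcop.pow (m := 5) (n := 5))))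
  rw [← h1, ← h2] at hab
  exact ⟨-6 * C s * a + 6 * C r * b, a * Q - b * P, by linear_combination hab⟩

end Sextic

/-! ### The sextic f_d as a sum of two sixth powers -/

section SexticPoly

variable {L : Type*} [Field L] [CharZero L] {d : ℚ} {p : L}

theorem natDegree_sexticPoly (h3 : d ≠ 3) (h3' : d ≠ -3) : (sexticPoly d).natDegree = 6 := by
  have h1 : d - 3 ≠ 0 := sub_ne_zero.2 h3
  have h2 : d + 3 ≠ 0 := fun h => h3' (eq_neg_of_add_eq_zero_left h)
  have h : 27 * (d - 3) / (d + 3) ≠ 0 := by positivity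
  rw [sexticPoly, natDegree_C_mul h]
  compute_degree!

/-- The first of the two coefficients of the sextic as a sum of two sixth powers. -/
def sexticCoeff (p : L) : L := -27 / 2 * (1 + p) / (1 - p)

/-- Substituting d = -3p² factors d + 3 as 3(1 - p)(1 + p), and the coefficients become those of A(x
- p)⁶ + B(x + p)⁶. -/
theorem coeff_sexticPoly (h3 : d ≠ 3) (h3' : d ≠ -3) (hp : 3 * p ^ 2 = -algebraMap ℚ L d)  :
    algebraMap ℚ L ((sexticPoly d).coeff 6) = sexticCoeff p + sexticCoeff (-p) ∧
    algebraMap ℚ L ((sexticPoly d).coeff 5) = 6 * p * (sexticCoeff (-p) - sexticCoeff p) ∧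
    algebraMap ℚ L ((sexticPoly d).coeff 4) = 15 * p ^ 2 * (sexticCoeff p + sexticCoeff (-p)) ∧
    algebraMap ℚ L ((sexticPoly d).coeff 3) = 20 * p ^ 3 * (sexticCoeff (-p) - sexticCoeff p) ∧
    algebraMap ℚ L ((sexticPoly d).coeff 2) = 15 * p ^ 4 * (sexticCoeff p + sexticCoeff (-p)) ∧
    algebraMap ℚ L ((sexticPoly d).coeff 1) = 6 * p ^ 5 * (sexticCoeff (-p) - sexticCoeff p) ∧
    algebraMap ℚ L ((sexticPoly d).coeff 0) = p ^ 6 * (sexticCoeff p + sexticCoeff (-p)) := by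
  have h1 : algebraMap ℚ L d - 3 ≠ 0 := by
    have := (algebraMap ℚ L).injective.ne h3
    rw [map_ofNat] at this
    exact sub_ne_zero.2 this
  have h2 : algebraMap ℚ L d + 3 ≠ 0 := by
    have := (algebraMap ℚ L).injective.ne h3'
    rw [map_neg, map_ofNat] at this
    exact fun h => this (eq_neg_of_add_eq_zero_left h)
  have hd : algebraMap ℚ L d = -3 * p ^ 2 := by rw [neg_mul, hp, neg_neg]
  have hd' : (d : L) = -3 * p ^ 2 := by rw [← hd, eq_ratCast]
  have hp1 : 1 - p ≠ 0 := fun h => h2 (by rw [hd]; linear_combination 3 * (1 + p) * h)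
  have hp2 : 1 + p ≠ 0 := fun h => h2 (by rw [hd]; linear_combination 3 * (1 - p) * h)
  have hp3 : 1 + p ^ 2 ≠ 0 := fun h => h1 (by rw [hd]; linear_combination (-3) * h)
  have e1 : -3 * p ^ 2 - 3 = -3 * (1 + p ^ 2) := by ring
  have e2 : -3 * p ^ 2 + 3 = 3 * ((1 - p) * (1 + p)) := by ring
  refine ⟨?_, ?_, ?_, ?_, ?_, ?_, ?_⟩ <;>
  · simp only [sexticPoly, coeff_C_mul, coeff_add, coeff_sub, coeff_X_pow, coeff_X, coeff_C]
    simp [sexticCoeff]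
    rw [hd', e1, e2, ← sub_eq_add_neg]
    field_simp
    ring

theorem binarySextic_sexticPoly (h3 : d ≠ 3) (h3' : d ≠ -3)
    (hp : 3 * p ^ 2 = -algebraMap ℚ L d) (s t : L) :
    binarySextic (sexticPoly d) s t =
      sexticCoeff p * (s - p * t) ^ 6 + sexticCoeff (-p) * (s + p * t) ^ 6 := by
  obtain ⟨c6, c5, c4, c3, c2, c1, c0⟩ := coeff_sexticPoly h3 h3' hp
  simp only [binarySextic, Finset.sum_range_succ, Finset.sum_range_zero, c6, c5, c4, c3, c2, c1, c0]
  ring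

theorem binarySextic_map_sexticPoly {A : Type*} [CommRing A] [Algebra L A] (h3 : d ≠ 3)
    (h3' : d ≠ -3) (hp : 3 * p ^ 2 = -algebraMap ℚ L d) (s t : A) :
    binarySextic ((sexticPoly d).map (algebraMap ℚ L)) s t =
      algebraMap L A (sexticCoeff p) * (s - algebraMap L A p * t) ^ 6 +
        algebraMap L A (sexticCoeff (-p)) * (s + algebraMap L A p * t) ^ 6 := by
  obtain ⟨c6, c5, c4, c3, c2, c1, c0⟩ := coeff_sexticPoly h3 h3' hp
  simp only [binarySextic, Finset.sum_range_succ, Finset.sum_range_zero, coeff_map, c6, c5, c4, c3,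
    c2, c1, c0, map_mul, map_add, map_sub, map_pow, map_ofNat]
  ring

theorem one_sub_ne_zero_of_sq (h3' : d ≠ -3) (hp : 3 * p ^ 2 = -algebraMap ℚ L d) :
    1 - p ≠ 0 := by
  intro h
  apply h3'
  apply (algebraMap ℚ L).injective
  rw [map_neg, map_ofNat]
  linear_combination 3 * (1 + p) * h + hp

theorem sexticCoeff_ne_zero (h3' : d ≠ -3) (hp : 3 * p ^ 2 = -algebraMap ℚ L d) :
    sexticCoeff p ≠ 0 := by
  have h1 := one_sub_ne_zero_of_sq h3' hp
  have h2 : 1 + p ≠ 0 := by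
    rw [← sub_neg_eq_add]
    exact one_sub_ne_zero_of_sq h3' (by rwa [neg_sq])
  exact div_ne_zero (mul_ne_zero (by norm_num) h2) h1

/-- Over the algebraic closure the linear forms are X ∓ p, or 1 ∓ pX for the reverse, with Wronskian
±2p. -/
theorem separable_sexticPoly (h0 : d ≠ 0) (h3 : d ≠ 3) (h3' : d ≠ -3) :
    (sexticPoly d).Separable ∧ (sexticPoly d).reverse.Separable := by
  obtain ⟨p, hp⟩ := IsAlgClosed.exists_pow_nat_eq (-algebraMap ℚ (AlgebraicClosure ℚ) d / 3) two_pos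
  have hp' : 3 * p ^ 2 = -algebraMap ℚ _ d := by rw [hp]; ring
  have hpm : 3 * (-p) ^ 2 = -algebraMap ℚ _ d := by rwa [neg_sq]
  have hp0 : p ≠ 0 := by
    rintro rfl
    apply h0
    apply (algebraMap ℚ (AlgebraicClosure ℚ)).injective
    rw [map_zero]
    linear_combination hp'
  have hA := sexticCoeff_ne_zero h3' hp'
  have hB := sexticCoeff_ne_zero h3' hpm
  have hdeg : ((sexticPoly d).map (algebraMap ℚ (AlgebraicClosure ℚ))).natDegree = 6 := by
    rw [natDegree_map, natDegree_sexticPoly h3 h3']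
  rw [← separable_map (algebraMap ℚ (AlgebraicClosure ℚ)),
    ← separable_map (algebraMap ℚ (AlgebraicClosure ℚ)) (p := (sexticPoly d).reverse)]
  have hrev : (sexticPoly d).reverse.map (algebraMap ℚ (AlgebraicClosure ℚ)) =
      ((sexticPoly d).map (algebraMap ℚ (AlgebraicClosure ℚ))).reverse := by
    rw [reverse, reverse, natDegree_map, reflect_map]
  rw [hrev]
  constructor
  · rw [← binarySextic_X_one hdeg, binarySextic_map_sexticPoly h3 h3' hp']
    refine separable_of_sum_sixth_powers (r := 1) (s := 1) (w := 2 * p) hA hB rfl ?_ ?_ ?_ ?_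
    · simp
    · simp
    · simpa using hp0
    · simp [show (C (2 : AlgebraicClosure ℚ)) = 2 from map_ofNat C 2]
      ring
  · rw [← binarySextic_one_X hdeg, binarySextic_map_sexticPoly h3 h3' hp']
    refine separable_of_sum_sixth_powers (r := -p) (s := p) (w := -2 * p) hA hB rfl ?_ ?_ ?_ ?_
    · simp
    · simp
    · simpa using hp0
    · simp [show (C (2 : AlgebraicClosure ℚ)) = 2 from map_ofNat C 2]
      ring

end SexticPoly

/-! ### Substitutions between sums of two sixth powers -/

section Classification

variable {L : Type*} [Field L]

/-- The two equations form a linear system in A'a⁴b and B'c⁴e with determinant ae - bc, so both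
vanish. -/
theorem diagonal_or_antidiagonal {A' B' a b c e : L} (hA : A' ≠ 0) (hB : B' ≠ 0)
    (hdet : a * e - b * c ≠ 0) (h5 : A' * a ^ 5 * b + B' * c ^ 5 * e = 0)
    (h4 : A' * a ^ 4 * b ^ 2 + B' * c ^ 4 * e ^ 2 = 0) : b = 0 ∧ c = 0 ∨ a = 0 ∧ e = 0 := by
  have h1 : A' * (a * e - b * c) * (a ^ 4 * b) = 0 := by linear_combination e * h5 - c * h4
  have h2 : B' * (a * e - b * c) * (c ^ 4 * e) = 0 := by linear_combination a * h4 - b * h5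
  have h1' : a = 0 ∨ b = 0 := by simpa [hA, hdet] using h1
  have h2' : c = 0 ∨ e = 0 := by simpa [hB, hdet] using h2
  rcases h1' with rfl | rfl <;> rcases h2' with rfl | rfl <;> simp_all

variable [CharZero L]

theorem coeff_eq_of_forall_sum_sixth_powers {A B A' B' κ a b c e : L}
    (h : ∀ T : L, T ≠ 1 → A' * (a * T + b) ^ 6 + B' * (c * T + e) ^ 6 = κ * (A * T ^ 6 + B)) :
    A' * a ^ 6 + B' * c ^ 6 = κ * A ∧ A' * a ^ 5 * b + B' * c ^ 5 * e = 0 ∧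
      A' * a ^ 4 * b ^ 2 + B' * c ^ 4 * e ^ 2 = 0 ∧ A' * b ^ 6 + B' * e ^ 6 = κ * B := by
  set P : L[X] := C (A' * a ^ 6 + B' * c ^ 6 - κ * A) * X ^ 6
    + C (6 * (A' * a ^ 5 * b + B' * c ^ 5 * e)) * X ^ 5
    + C (15 * (A' * a ^ 4 * b ^ 2 + B' * c ^ 4 * e ^ 2)) * X ^ 4
    + C (20 * (A' * a ^ 3 * b ^ 3 + B' * c ^ 3 * e ^ 3)) * X ^ 3
    + C (15 * (A' * a ^ 2 * b ^ 4 + B' * c ^ 2 * e ^ 4)) * X ^ 2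
    + C (6 * (A' * a * b ^ 5 + B' * c * e ^ 5)) * X
    + C (A' * b ^ 6 + B' * e ^ 6 - κ * B) with hP
  -- The factor X - 1 absorbs the excluded value T = 1, which is t = ∞ for T = (t - p)/(t + p).
  have h0 : (X - C 1) * P = 0 := by
    refine Polynomial.funext fun T => ?_
    by_cases hT : T = 1
    · simp [hT]
    · have : P.eval T = 0 := by
        simp only [hP, eval_add, eval_mul, eval_C, eval_pow, eval_X]
        linear_combination h T hT
      rw [eval_mul, this, mul_zero, eval_zero]
  have hP0 : P = 0 := (mul_eq_zero.1 h0).resolve_left (X_sub_C_ne_zero 1)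
  have h6 := congrArg (coeff · 6) hP0
  have h5 := congrArg (coeff · 5) hP0
  have h4 := congrArg (coeff · 4) hP0
  have hc0 := congrArg (coeff · 0) hP0
  simp only [hP, coeff_add, coeff_C_mul, coeff_X_pow, coeff_X, coeff_C, coeff_zero] at h6 h5 h4 hc0
  norm_num at h6 h5 h4 hc0
  exact ⟨by linear_combination h6, h5, h4, by linear_combination hc0⟩

/-- A linear substitution that carries one sum of two sixth powers to another one permutes the two
powers. -/
theorem diagonal_or_antidiagonal_of_forall {A B A' B' κ p p' a b c e : L} (hp : p ≠ 0)
    (hA : A' ≠ 0) (hB : B' ≠ 0) (hp' : p' ≠ 0) (hdet : a * e - b * c ≠ 0)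
    (h : ∀ t : L, A' * ((a * t + b) - p' * (c * t + e)) ^ 6 +
      B' * ((a * t + b) + p' * (c * t + e)) ^ 6 = κ * (A * (t - p) ^ 6 + B * (t + p) ^ 6)) :
    ∃ a' b' c' e' : L, a' + b' = a - p' * c ∧ p * (b' - a') = b - p' * e ∧
      c' + e' = a + p' * c ∧ p * (e' - c') = b + p' * e ∧
      (b' = 0 ∧ c' = 0 ∨ a' = 0 ∧ e' = 0) ∧
      A' * a' ^ 6 + B' * c' ^ 6 = κ * A ∧ A' * b' ^ 6 + B' * e' ^ 6 = κ * B := by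
  -- The new entries expand (at + b) ∓ p'(ct + e) in the basis t - p, t + p.
  refine ⟨((a - p' * c) - (b - p' * e) / p) / 2, ((a - p' * c) + (b - p' * e) / p) / 2,
    ((a + p' * c) - (b + p' * e) / p) / 2, ((a + p' * c) + (b + p' * e) / p) / 2, by ring,
    by field_simp; ring, by ring, by field_simp; ring, ?_⟩
  set a' := ((a - p' * c) - (b - p' * e) / p) / 2 with ha'
  set b' := ((a - p' * c) + (b - p' * e) / p) / 2 with hb'
  set c' := ((a + p' * c) - (b + p' * e) / p) / 2 with hc'
  set e' := ((a + p' * c) + (b + p' * e) / p) / 2 with he'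
  have h1 : a' + b' = a - p' * c := by rw [ha', hb']; ring
  have h2 : p * (b' - a') = b - p' * e := by rw [ha', hb']; field_simp; ring
  have h3 : c' + e' = a + p' * c := by rw [hc', he']; ring
  have h4 : p * (e' - c') = b + p' * e := by rw [hc', he']; field_simp; ring
  have hdet' : a' * e' - b' * c' ≠ 0 := by
    have : p * (a' * e' - b' * c') = p' * (a * e - b * c) := by
      linear_combination (1 / 2 : L) * ((a' + b') * h4 + h1 * (b + p' * e)
        - (c' + e') * h2 - h3 * (b - p' * e))
    intro h0
    rw [h0, mul_zero] at this
    exact mul_ne_zero hp' hdet this.symm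
  have hT : ∀ T : L, T ≠ 1 → A' * (a' * T + b') ^ 6 + B' * (c' * T + e') ^ 6 =
      κ * (A * T ^ 6 + B) := by
    intro T hT
    have hT' : 1 - T ≠ 0 := sub_ne_zero.2 (Ne.symm hT)
    -- w is t + p for the t with T = (t - p)/(t + p), so t - p = wT.
    set w := 2 * p / (1 - T) with hw
    have hw1 : w * (1 - T) = 2 * p := div_mul_cancel₀ _ hT'
    have hw0 : w ≠ 0 := div_ne_zero (mul_ne_zero two_ne_zero hp) hT'
    have key := h (w - p)
    have e1 : (a * (w - p) + b) - p' * (c * (w - p) + e) = w * (a' * T + b') := by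
      linear_combination (p - w) * h1 - h2 + a' * hw1
    have e2 : (a * (w - p) + b) + p' * (c * (w - p) + e) = w * (c' * T + e') := by
      linear_combination (p - w) * h3 - h4 + c' * hw1
    have e3 : w - p - p = w * T := by linear_combination hw1
    have e4 : w - p + p = w := by ring
    rw [e1, e2, e3, e4] at key
    refine mul_left_cancel₀ (pow_ne_zero 6 hw0) ?_
    linear_combination key
  obtain ⟨k6, k5, k4, k0⟩ := coeff_eq_of_forall_sum_sixth_powers hT
  exact ⟨diagonal_or_antidiagonal hA hB hdet' k5 k4, k6, k0⟩

end Classification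

/-! ### Square classes and rational fractional linear maps -/

section Arithmetic

theorem eq_of_squarefree_of_mul_eq_sq {m n k : ℤ} (hm : Squarefree m) (hn : Squarefree n)
    (h : m * n = k ^ 2) : m = n := by
  obtain ⟨j, rfl⟩ : m ∣ k := (hm.dvd_pow_iff_dvd two_ne_zero).1 ⟨n, h.symm⟩
  have hn' : n = m * (j * j) := mul_left_cancel₀ hm.ne_zero (by rw [h]; ring)
  have hj : IsUnit j := hn j ⟨m, by rw [hn']; ring⟩
  rcases Int.isUnit_iff.1 hj with rfl | rfl <;> simp [hn']

theorem eq_of_squarefree_of_mul_eq_ratCast_sq {m n : ℤ} (hm : Squarefree m) (hn : Squarefree n)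
    {q : ℚ} (h : (m : ℚ) * n = q ^ 2) : m = n := by
  have : IsSquare ((m * n : ℤ) : ℚ) := ⟨q, by rw [Int.cast_mul, h, sq]⟩
  obtain ⟨k, hk⟩ := Rat.isSquare_intCast_iff.1 this
  exact eq_of_squarefree_of_mul_eq_sq hm hn (k := k) (by rw [hk, sq])

/-- Two quadratic irrationalities without trace that are related by a rational fractional linear
transformation generate the same field. -/
theorem exists_mul_eq_sq_of_moebius {L : Type*} [Field L] [CharZero L] {P P' a b c e : ℚ}
    (hP : ¬ IsSquare P) (hP' : P' ≠ 0) (hdet : a * e - b * c ≠ 0) {p p' : L}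
    (hp : p ^ 2 = algebraMap ℚ L P) (hp' : p' ^ 2 = algebraMap ℚ L P')
    (h : algebraMap ℚ L a * p + algebraMap ℚ L b =
      p' * (algebraMap ℚ L c * p + algebraMap ℚ L e)) : ∃ q : ℚ, P * P' = q ^ 2 := by
  have hlin : ∀ u v : ℚ, algebraMap ℚ L u * p = algebraMap ℚ L v → u = 0 ∧ v = 0 := by
    intro u v huv
    by_cases hu : u = 0
    · subst hu
      rw [map_zero, zero_mul, eq_comm, map_eq_zero] at huv
      exact ⟨rfl, huv⟩
    · refine absurd ⟨v / u, ?_⟩ hP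
      apply (algebraMap ℚ L).injective
      have hu' : algebraMap ℚ L u ≠ 0 := (_root_.map_ne_zero _).2 hu
      rw [map_mul, map_div₀, ← huv, mul_div_cancel_left₀ _ hu', ← hp, sq]
  -- Square both sides of `h` and compare coefficients of 1 and p, independent over ℚ because P is
  -- not a square.
  obtain ⟨h1, h2⟩ := hlin (2 * (a * b - P' * (c * e)))
    (P' * (c ^ 2 * P + e ^ 2) - (a ^ 2 * P + b ^ 2)) (by
      simp only [map_mul, map_sub, map_add, map_pow, map_ofNat, ← hp, ← hp']
      linear_combination ((algebraMap ℚ L a * p + algebraMap ℚ L b) +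
        p' * (algebraMap ℚ L c * p + algebraMap ℚ L e)) * h)
  have h3 : a * b = P' * (c * e) := by linear_combination h1 / 2
  by_cases hc : c = 0
  · subst hc
    have ha : a ≠ 0 := by rintro rfl; simp at hdet
    have hb : b = 0 := by simpa [ha] using h3
    subst hb
    refine ⟨P' * e / a, ?_⟩
    field_simp
    linear_combination -h2
  · by_cases he : e = 0
    · subst he
      have hb : b ≠ 0 := by rintro rfl; simp at hdet
      have ha : a = 0 := by simpa [hb] using h3
      subst ha
      refine ⟨b / c, ?_⟩
      field_simp
      linear_combination h2
    · have ha : a ≠ 0 := by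
        rintro rfl
        simp [hP', hc, he] at h3
      have h4 : a * c * P = b * e := by
        refine mul_left_cancel₀ hdet ?_
        linear_combination (-c * e) * h2 - (c ^ 2 * P + e ^ 2) * h3
      -- Multiply acP = be by ab = P'ce and cancel ae.
      refine ⟨b / c, ?_⟩
      rw [div_pow, eq_div_iff (pow_ne_zero 2 hc)]
      refine mul_left_cancel₀ (mul_ne_zero ha he) ?_
      linear_combination P' * c * e * h4 - b * e * h3

end Arithmetic

theorem exists_isPresentation_functionField_one {K : Type*} [Field K] {f : K[X]}
    (hf : Squarefree f) (hu : ¬ IsUnit f) [IsDomain (CoordinateRing 1 f)] :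
    ∃ x y : FunctionField 1 f, IsPresentation f x y := by
  have h1 : C (1 : K)⁻¹ * f = f := by rw [inv_one, C_1, one_mul]
  have h2 := exists_isPresentation_functionField (one_ne_zero (α := K)) hf hu
  rwa [h1] at h2

/-! ### The Galois action in terms of matrices -/

section Galois

variable {K L E : Type*} [Field K] [Field L] [Algebra K L] [Field E] [Algebra L E]

/-- Conjugation by a semilinear automorphism fixes all automorphisms of a function field if and
only if the semilinear automorphism fixes the images of the coordinates. -/
theorem IsPresentation.exists_ringHom_conj_eq_iff {T : Type*} [CommRing T] [Algebra L T]
    {f : L[X]} {x y : E} (h : IsPresentation f x y) (φ : T ≃ₐ[L] E) {G : T →+* T} {G' : T → T}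
    {σ : L → L} (hG : ∀ a, G (algebraMap L T a) = algebraMap L T (σ a)) {x₀ y₀ : T}
    (hx : φ x₀ = x) (hy : φ y₀ = y) (hGx : G x₀ = x₀) (hGy : G y₀ = y₀) (hGx' : G' x₀ = x₀)
    (hGy' : G' y₀ = y₀) {conj : (T ≃ₐ[L] T) → (T ≃ₐ[L] T)}
    (hconj : ∀ ψ z, conj ψ z = G (ψ (G' z))) :
    ∃ S : E →+* E, (∀ a, S (algebraMap L E a) = algebraMap L E (σ a)) ∧ S x = x ∧ S y = y ∧
      ((∀ ψ, conj ψ = ψ) ↔ ∀ ψ : E ≃ₐ[L] E, S (ψ x) = ψ x ∧ S (ψ y) = ψ y) := by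
  let S : E →+* E := (φ : T →+* E).comp (G.comp (φ.symm : E →+* T))
  have hSφ : ∀ z, S (φ z) = φ (G z) := fun z => by simp [S]
  have hSx : S x = x := by rw [← hx, hSφ, hGx]
  have hSy : S y = y := by rw [← hy, hSφ, hGy]
  refine ⟨S, fun a => ?_, hSx, hSy, ?_⟩
  · rw [← φ.commutes, hSφ, hG, φ.commutes]
  constructor
  · intro hc ψ
    let ψ' : T ≃ₐ[L] T := (φ.trans ψ).trans φ.symm
    have key : ∀ z : T, G' z = z → S (ψ (φ z)) = ψ (φ z) := by
      intro z hz
      have h1 : ψ (φ z) = φ (ψ' z) := by simp [ψ']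
      have h2 := DFunLike.congr_fun (hc ψ') z
      rw [hconj, hz] at h2
      rw [h1, hSφ, h2]
    exact ⟨by rw [← hx, key _ hGx'], by rw [← hy, key _ hGy']⟩
  · intro hψ ψ
    let ψ₁ : E ≃ₐ[L] E := (φ.symm.trans ψ).trans φ
    let ψ₂ : E ≃ₐ[L] E := (φ.symm.trans (conj ψ)).trans φ
    have key : ∀ z : T, G' z = z → ψ₂ (φ z) = S (ψ₁ (φ z)) := by
      intro z hz
      have h1 : ψ₁ (φ z) = φ (ψ z) := by simp [ψ₁]
      have h2 : ψ₂ (φ z) = φ (conj ψ z) := by simp [ψ₂]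
      rw [h1, h2, hSφ, hconj, hz]
    have heq : (ψ₂ : E →ₐ[L] E) = ψ₁ := by
      refine h.algHom_ext ?_ ?_
      · change ψ₂ x = ψ₁ x
        rw [← (hψ ψ₁).1, ← hx, key _ hGx']
      · change ψ₂ y = ψ₁ y
        rw [← (hψ ψ₁).2, ← hy, key _ hGy']
    ext z
    have h1 := DFunLike.congr_fun heq (φ z)
    change ψ₂ (φ z) = ψ₁ (φ z) at h1
    apply φ.injective
    simpa [ψ₁, ψ₂] using h1

theorem mem_ker_galoisAction_iff_forall_galoisConj {f : K[X]} (σ : L ≃ₐ[K] L) :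
    σ ∈ (galoisAction L f).ker ↔ ∀ ψ : AutGroup L f, galoisConj f σ ψ = ψ := by
  rw [MonoidHom.mem_ker]
  exact ⟨fun h ψ => DFunLike.congr_fun h ψ, fun h => MulEquiv.ext h⟩

theorem galoisOnFunctions_one_tmul {f : K[X]} (σ : L ≃ₐ[K] L) (z : FunctionField (1 : K) f) :
    galoisOnFunctions f σ (1 ⊗ₜ[K] z) = 1 ⊗ₜ[K] z :=
  (galoisOnFunctions_tmul f σ 1 z).trans (congrArg (fun a : L => a ⊗ₜ[K] z) (map_one σ))

/-- This trades L ⊗ K(C) for an arbitrary field E presenting the base-changed curve; S is σ acting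
on constants. -/
theorem exists_ringHom_mem_ker_galoisAction_iff [Algebra.IsAlgebraic K L] {f : K[X]}
    (hf : f.Separable) (hu : ¬ IsUnit f) {x y : E}
    (h : IsPresentation (f.map (algebraMap K L)) x y) (σ : L ≃ₐ[K] L) :
    ∃ S : E →+* E, (∀ a, S (algebraMap L E a) = algebraMap L E (σ a)) ∧ S x = x ∧ S y = y ∧
      (σ ∈ (galoisAction L f).ker ↔ ∀ ψ : E ≃ₐ[L] E, S (ψ x) = ψ x ∧ S (ψ y) = ψ y) := by
  have hdom := isDomain_coordinateRing (one_ne_zero (α := K)) hf.squarefree hu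
  obtain ⟨x₀, y₀, h₀⟩ := exists_isPresentation_functionField_one hf.squarefree hu
  obtain ⟨φ, hφx, hφy⟩ := exists_baseChange_algEquiv hf.squarefree hu h₀ hf.map.squarefree h
  rw [mem_ker_galoisAction_iff_forall_galoisConj]
  have hx := galoisOnFunctions_one_tmul σ x₀
  have hy := galoisOnFunctions_one_tmul σ y₀
  have hx' := galoisOnFunctions_one_tmul σ⁻¹ x₀
  have hy' := galoisOnFunctions_one_tmul σ⁻¹ y₀
  let φ' : BaseChangeFunctionField L f ≃ₐ[L] E := φ
  exact h.exists_ringHom_conj_eq_iff φ'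
    (G := (galoisOnFunctions f σ : BaseChangeFunctionField L f →+* BaseChangeFunctionField L f))
    (galoisOnFunctions_algebraMap f σ) hφx hφy hx hy hx' hy' (galoisConj_apply f σ)

/-- An element of the Galois group acts trivially on the automorphisms of a curve of genus two if
and only if it fixes the matrices of all automorphisms. -/
theorem mem_ker_galoisAction_iff [Algebra.IsAlgebraic K L] [CharZero L] {f : K[X]}
    (hf : f.Separable) (hfr : f.reverse.Separable) (hfd : f.natDegree = 6) (σ : L ≃ₐ[K] L) :
    σ ∈ (galoisAction L f).ker ↔ ∀ a b c e : L, a * e - b * c ≠ 0 →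
      (binarySextic (f.map (algebraMap K L)) (C a * X + C b) (C c * X + C e) : L[X]) =
        C ((a * e - b * c) ^ 2) * f.map (algebraMap K L) →
      σ a = a ∧ σ b = b ∧ σ c = c ∧ σ e = e := by
  have hu : ¬ IsUnit f := fun hu => by simp [natDegree_eq_zero_of_isUnit hu] at hfd
  set g := f.map (algebraMap K L) with hgdef
  have hg : g.Separable := hf.map
  have hgu : ¬ IsUnit g := by rwa [hgdef, isUnit_map]
  have hgr : g.reverse.Separable := by
    have : g.reverse = f.reverse.map (algebraMap K L) := by
      rw [reverse, reverse, hgdef, natDegree_map, reflect_map]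
    rw [this]
    exact hfr.map
  have hgd : g.natDegree = 6 := by rw [hgdef, natDegree_map, hfd]
  have hdom := isDomain_coordinateRing (one_ne_zero (α := L)) hg.squarefree hgu
  obtain ⟨x, y, h⟩ := exists_isPresentation_functionField_one hg.squarefree hgu
  obtain ⟨S, hS, hSx, hSy, hiff⟩ := exists_ringHom_mem_ker_galoisAction_iff hf hu h σ
  rw [hiff]
  constructor
  · intro hψ a b c e hdet hM
    obtain ⟨ψ, hψx, hψy⟩ := h.exists_algEquiv_of_binarySextic hg.squarefree hgd hdet hM
    exact h.fixed_of_fixed hg.ne_zero (σ := (σ : L →+* L)) hS hSx hSy hdet hψx hψy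
      (hψ ψ).1 (hψ ψ).2
  · intro hM ψ
    obtain ⟨D, hD⟩ := exists_derivation_of_isPresentation h
    obtain ⟨a, b, c, e, -, hu, hv, hw, hdet, hsextic⟩ :=
      h.exists_moebius hg hgr hgd (h.map_algEquiv ψ) hg hgr hgd hD
    obtain ⟨ha, hb, hc, he⟩ := hM a b c e hdet hsextic
    exact fixed_of_fixed_matrix (σ := (σ : L →+* L)) hS hSx hSy hw hu hv ha hb hc he

end Galois

/-! ### Fixing all automorphism matrices of f_d -/

section FieldOfDefinition

variable {L : Type*} [Field L] [CharZero L]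

/-- Sixth roots of unity are ± cube roots of unity, and the nontrivial cube roots are (±s - 1)/2. -/
theorem apply_eq_of_pow_six_eq_one {σ : L →+* L} {s z : L} (hs : s ^ 2 = -3) (hσ : σ s = s)
    (hz : z ^ 6 = 1) : σ z = z := by
  have key : ∀ z : L, z ^ 2 + z + 1 = 0 → σ z = z := by
    intro z hz
    have h1 : (2 * z + 1 - s) * (2 * z + 1 + s) = 0 := by linear_combination 4 * hz - hs
    rcases mul_eq_zero.1 h1 with h | h
    · have : z = (s - 1) / 2 := by linear_combination h / 2
      rw [this, map_div₀, map_sub, hσ, map_one, map_ofNat]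
    · have : z = (-s - 1) / 2 := by linear_combination h / 2
      rw [this, map_div₀, map_sub, map_neg, hσ, map_one, map_ofNat]
  have h1 : (z - 1) * ((z + 1) * ((z ^ 2 + z + 1) * ((-z) ^ 2 + -z + 1))) = 0 := by
    linear_combination hz
  rcases mul_eq_zero.1 h1 with h | h
  · rw [sub_eq_zero.1 h, map_one]
  rcases mul_eq_zero.1 h with h | h
  · rw [eq_neg_of_add_eq_zero_left h, map_neg, map_one]
  rcases mul_eq_zero.1 h with h | h
  · exact key z h
  · have := key _ h
    rwa [map_neg, neg_inj] at this

theorem apply_eq_of_sq_eq_sq {σ : L →+* L} {y z : L} (h : y ^ 2 = z ^ 2) (hσ : σ z = z) :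
    σ y = y := by
  rcases sq_eq_sq_iff_eq_or_eq_neg.1 h with rfl | rfl
  · exact hσ
  · rw [map_neg, hσ]

/-- If `σ` fixes the invariants `p`, `√-3` and `β`, it fixes all matrices that preserve the sum
of sixth powers `A (X - p)⁶ + B (X + p)⁶` with `B = β⁶ A`. -/
theorem apply_matrix_eq {σ : L →+* L} {s p β A B : L} (hs : s ^ 2 = -3) (hσs : σ s = s)
    (hp : p ≠ 0) (hσp : σ p = p) (hβ : β ≠ 0) (hσβ : σ β = β) (hA : A ≠ 0) (hB : B ≠ 0)
    (hAB : B = β ^ 6 * A) {a b c e : L} (hdet : a * e - b * c ≠ 0)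
    (h : ∀ t : L, A * ((a * t + b) - p * (c * t + e)) ^ 6 +
      B * ((a * t + b) + p * (c * t + e)) ^ 6 =
        (a * e - b * c) ^ 2 * (A * (t - p) ^ 6 + B * (t + p) ^ 6)) :
    σ a = a ∧ σ b = b ∧ σ c = c ∧ σ e = e := by
  obtain ⟨a', b', c', e', h1, h2, h3, h4, hcase, h6, h0⟩ :=
    diagonal_or_antidiagonal_of_forall hp hA hB hp hdet h
  -- Source and target use the same basis, so passing to it is a conjugation.
  have hdet' : a' * e' - b' * c' = a * e - b * c := by
    refine mul_left_cancel₀ hp ?_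
    linear_combination (1 / 2 : L) * ((a' + b') * h4 + h1 * (b + p * e)
        - (c' + e') * h2 - h3 * (b - p * e))
  rw [← hdet'] at h6 h0 hdet
  have hfix : σ a' = a' ∧ σ b' = b' ∧ σ c' = c' ∧ σ e' = e' := by
    rcases hcase with ⟨rfl, rfl⟩ | ⟨rfl, rfl⟩
    · have ha0 : a' ≠ 0 := by rintro rfl; simp at hdet
      have he0 : e' ≠ 0 := by rintro rfl; simp at hdet
      have k1 : e' ^ 2 = (a' ^ 2) ^ 2 := by
        refine mul_left_cancel₀ (mul_ne_zero hA (pow_ne_zero 2 ha0)) ?_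
        linear_combination -h6
      have k2 : (e' ^ 2) ^ 2 = a' ^ 2 := by
        refine mul_left_cancel₀ (mul_ne_zero hB (pow_ne_zero 2 he0)) ?_
        linear_combination h0
      have k3 : a' ^ 6 = 1 := by
        refine mul_left_cancel₀ (pow_ne_zero 2 ha0) ?_
        rw [k1] at k2
        linear_combination k2
      have hσa := apply_eq_of_pow_six_eq_one hs hσs k3
      exact ⟨hσa, map_zero σ, map_zero σ,
        apply_eq_of_sq_eq_sq k1 (by rw [map_pow, hσa])⟩
    · have hb0 : b' ≠ 0 := by rintro rfl; simp at hdet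
      have hc0 : c' ≠ 0 := by rintro rfl; simp at hdet
      subst hAB
      have k1 : β ^ 6 * (c' ^ 2) ^ 2 = b' ^ 2 := by
        refine mul_left_cancel₀ (mul_ne_zero hA (pow_ne_zero 2 hc0)) ?_
        linear_combination h6
      have k2 : (b' ^ 2) ^ 2 = c' ^ 2 * β ^ 6 := by
        refine mul_left_cancel₀ (mul_ne_zero hA (pow_ne_zero 2 hb0)) ?_
        linear_combination h0
      have k3 : c' ^ 2 * b' ^ 2 = 1 := by
        refine mul_left_cancel₀ (pow_ne_zero 2 hb0) ?_
        linear_combination c' ^ 2 * k2 + k1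
      -- In the antidiagonal case b' is β times a sixth root of unity, and c' = ±1/b'.
      have k4 : b' ^ 6 = β ^ 6 := by linear_combination b' ^ 2 * k2 + β ^ 6 * k3
      have k5 : (b' / β) ^ 6 = 1 := by rw [div_pow, k4, div_self (pow_ne_zero 6 hβ)]
      have hσb : σ b' = b' := by
        have := apply_eq_of_pow_six_eq_one hs hσs k5
        rwa [map_div₀, hσβ, div_left_inj' hβ] at this
      refine ⟨map_zero σ, hσb, apply_eq_of_sq_eq_sq (z := b'⁻¹) ?_ (by rw [map_inv₀, hσb]),
        map_zero σ⟩
      rw [inv_pow]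
      exact eq_inv_of_mul_eq_one_left k3
  obtain ⟨ha, hb, hc, he⟩ := hfix
  have ea : a = (a' + b' + c' + e') / 2 := by linear_combination (-1 / 2 : L) * (h1 + h3)
  have eb : b = p * (b' - a' + e' - c') / 2 := by linear_combination (-1 / 2 : L) * (h2 + h4)
  have ec : c = (c' + e' - a' - b') / (2 * p) := by
    field_simp
    linear_combination h1 - h3
  have ee : e = (e' - c' - b' + a') / 2 := by
    refine mul_left_cancel₀ hp ?_
    linear_combination (1 / 2 : L) * (h2 - h4)
  refine ⟨?_, ?_, ?_, ?_⟩
  · rw [ea]; simp only [map_div₀, map_add, map_ofNat, ha, hb, hc, he]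
  · rw [eb]; simp only [map_div₀, map_add, map_sub, map_mul, map_ofNat, ha, hb, hc, he, hσp]
  · rw [ec]; simp only [map_div₀, map_add, map_sub, map_mul, map_ofNat, ha, hb, hc, he, hσp]
  · rw [ee]; simp only [map_div₀, map_add, map_sub, map_ofNat, ha, hb, hc, he]

/-- A sixth root of the ratio of the two coefficients in terms of the root of the cubic. -/
theorem exists_sixth_root {p α : L} (hp0 : p ≠ 0) (hp1 : 1 - p ≠ 0) (hp2 : 1 + p ≠ 0)
    (hα : (4 * α ^ 3 - 3 * α) * (1 - p ^ 2) = -(1 + p ^ 2)) :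
    4 * α ^ 2 - 1 ≠ 0 ∧
    (-2 * p / ((1 - p ^ 2) * (4 * α ^ 2 - 1))) ^ 2 = α ^ 2 - 1 ∧
    sexticCoeff (-p) =
      (-2 * p / ((1 - p ^ 2) * (4 * α ^ 2 - 1)) - α) ^ 6 * sexticCoeff p := by
  have hp : 1 - p ^ 2 ≠ 0 := by
    rw [show 1 - p ^ 2 = (1 - p) * (1 + p) by ring]
    exact mul_ne_zero hp1 hp2
  -- Triple-angle identity (4α³ - 3α)² - 1 = (α² - 1)(4α² - 1)², with α in the role of a cosine and
  -- γ of i times a sine.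
  have hsq : (1 - p ^ 2) ^ 2 * (4 * α ^ 2 - 1) ^ 2 * (α ^ 2 - 1) = (2 * p) ^ 2 := by
    linear_combination ((4 * α ^ 3 - 3 * α) * (1 - p ^ 2) - (1 + p ^ 2)) * hα
  have hα1 : 4 * α ^ 2 - 1 ≠ 0 := by
    intro h0
    rw [h0] at hsq
    have : (2 * p) ^ 2 ≠ 0 := pow_ne_zero 2 (mul_ne_zero two_ne_zero hp0)
    exact this (by rw [← hsq]; ring)
  set γ := -2 * p / ((1 - p ^ 2) * (4 * α ^ 2 - 1)) with hγ
  have hγ1 : γ * ((1 - p ^ 2) * (4 * α ^ 2 - 1)) = -2 * p :=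
    div_mul_cancel₀ _ (mul_ne_zero hp hα1)
  have hγ2 : γ ^ 2 = α ^ 2 - 1 := by
    refine mul_right_cancel₀ (pow_ne_zero 2 (mul_ne_zero hp hα1)) ?_
    rw [← mul_pow, hγ1]
    linear_combination -hsq
  refine ⟨hα1, hγ2, ?_⟩
  -- De Moivre's formula: (γ - α)³ = γ(4α² - 1) - (4α³ - 3α) = (1 - p)/(1 + p), whose square is B/A.
  have h3 : (γ - α) ^ 3 * (1 + p) = 1 - p := by
    refine mul_left_cancel₀ hp1 ?_
    have e1 : (γ - α) ^ 3 = γ * (4 * α ^ 2 - 1) - (4 * α ^ 3 - 3 * α) := by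
      linear_combination (γ - 3 * α) * hγ2
    rw [e1]
    linear_combination hγ1 - hα
  have h6 : (γ - α) ^ 6 * (1 + p) ^ 2 = (1 - p) ^ 2 := by
    linear_combination ((γ - α) ^ 3 * (1 + p) + (1 - p)) * h3
  rw [sexticCoeff, sexticCoeff, sub_neg_eq_add, ← sub_eq_add_neg]
  field_simp
  linear_combination h6

end FieldOfDefinition

/-! ### The field of definition and the twist classes -/

section Main

theorem binarySextic_map_sexticPoly_eq_iff {L : Type*} [Field L] [CharZero L] {d : ℚ} {p : L}
    (h3 : d ≠ 3) (h3' : d ≠ -3) (hp : 3 * p ^ 2 = -algebraMap ℚ L d) (a b c e k : L) :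
    (binarySextic ((sexticPoly d).map (algebraMap ℚ L)) (C a * X + C b) (C c * X + C e) : L[X]) =
        C k * (sexticPoly d).map (algebraMap ℚ L) ↔
      ∀ t : L, sexticCoeff p * ((a * t + b) - p * (c * t + e)) ^ 6 +
        sexticCoeff (-p) * ((a * t + b) + p * (c * t + e)) ^ 6 =
          k * (sexticCoeff p * (t - p) ^ 6 + sexticCoeff (-p) * (t + p) ^ 6) := by
  have hdeg : ((sexticPoly d).map (algebraMap ℚ L)).natDegree = 6 := by
    rw [natDegree_map, natDegree_sexticPoly h3 h3']
  have hf := binarySextic_X_one hdeg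
  rw [binarySextic_map_sexticPoly h3 h3' hp] at hf ⊢
  conv_lhs => rw [← hf]
  constructor
  · intro h t
    simpa using congrArg (eval t) h
  · intro h
    refine Polynomial.funext fun t => ?_
    simpa using h t

theorem mem_ker_galoisAction_sexticPoly_iff {L : Type*} [Field L] [CharZero L]
    [Algebra.IsAlgebraic ℚ L] {d : ℚ} (h0 : d ≠ 0) (h3 : d ≠ 3) (h3' : d ≠ -3) {α r s : L}
    (hα : aeval α (cubicPoly d) = 0) (hr : r ^ 2 = algebraMap ℚ L d) (hs : s ^ 2 = -3)
    (σ : L ≃ₐ[ℚ] L) :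
    σ ∈ (galoisAction L (sexticPoly d)).ker ↔ σ α = α ∧ σ r = r ∧ σ s = s := by
  obtain ⟨hsep, hsepr⟩ := separable_sexticPoly h0 h3 h3'
  rw [mem_ker_galoisAction_iff hsep hsepr (natDegree_sexticPoly h3 h3')]
  obtain ⟨p, hpdef⟩ : ∃ p : L, 3 * p = r * s := ⟨r * s / 3, by ring⟩
  have hp : 3 * p ^ 2 = -algebraMap ℚ L d := by
    linear_combination (1 / 3 : L) * (3 * p + r * s) * hpdef + (1 / 3 : L) * s ^ 2 * hr
      + (1 / 3 : L) * algebraMap ℚ L d * hs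
  have hpm : 3 * (-p) ^ 2 = -algebraMap ℚ L d := by rwa [neg_sq]
  have hp0 : p ≠ 0 := by
    rintro rfl
    apply h0
    apply (algebraMap ℚ L).injective
    rw [map_zero]
    linear_combination hp
  have hp1 := one_sub_ne_zero_of_sq h3' hp
  have hp2 : 1 + p ≠ 0 := by
    rw [← sub_neg_eq_add]
    exact one_sub_ne_zero_of_sq h3' hpm
  have hA := sexticCoeff_ne_zero h3' hp
  have hB := sexticCoeff_ne_zero h3' hpm
  have hs0 : s ≠ 0 := by
    rintro rfl
    norm_num at hs
  have hcubic : (4 * α ^ 3 - 3 * α) * (1 - p ^ 2) = -(1 + p ^ 2) := by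
    have hd3 : algebraMap ℚ L d + 3 ≠ 0 := by
      rw [show algebraMap ℚ L d + 3 = 3 * ((1 - p) * (1 + p)) by linear_combination hp]
      exact mul_ne_zero three_ne_zero (mul_ne_zero hp1 hp2)
    simp only [cubicPoly, map_sub, map_mul, map_pow, aeval_X, aeval_C, map_div₀, map_add,
      map_ofNat] at hα
    field_simp at hα
    linear_combination (1 / 3 : L) * hα - (1 / 3 : L) * (4 * α ^ 3 - 3 * α - 1) * hp
  obtain ⟨hα1, hγ2, hsix⟩ := exists_sixth_root hp0 hp1 hp2 hcubic
  set γ := -2 * p / ((1 - p ^ 2) * (4 * α ^ 2 - 1)) with hγ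
  simp only [binarySextic_map_sexticPoly_eq_iff h3 h3' hp]
  constructor
  · intro h
    have hσp : σ p = p := by
      -- The automorphism diag(1, -1) in the basis t ∓ p; on x it is p²/x.
      have := (h 0 (-p) (-1 / p) 0 (by field_simp; norm_num) fun t => by field_simp; ring).2.1
      rwa [map_neg, neg_inj] at this
    have hσs : σ s = s := by
      have hω : (s - 1) ^ 6 = 64 := by
        linear_combination (s ^ 4 - 6 * s ^ 3 + 12 * s ^ 2 - 2 * s - 21) * hs
      have hω' : (s + 1) ^ 6 = 64 := by
        linear_combination (s ^ 4 + 6 * s ^ 3 + 12 * s ^ 2 + 2 * s - 21) * hs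
      have hdet : (-1 / 2 : L) * (-1 / 2) - (-p * s / 2) * (-s / (2 * p)) = 1 := by
        field_simp
        linear_combination -hs
      -- The automorphism diag(ω, ω²) with ω = (s - 1)/2; its upper right entry detects s once p is
      -- fixed.
      have := (h (-1 / 2) (-p * s / 2) (-s / (2 * p)) (-1 / 2) (by rw [hdet]; exact one_ne_zero)
        fun t => by
          rw [hdet, show -1 / 2 * t + -p * s / 2 - p * (-s / (2 * p) * t + -1 / 2) =
            (s - 1) / 2 * (t - p) by field_simp; ring,
            show -1 / 2 * t + -p * s / 2 + p * (-s / (2 * p) * t + -1 / 2) =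
            -(s + 1) / 2 * (t + p) by field_simp; ring]
          linear_combination (1 / 64 : L) * sexticCoeff p * (t - p) ^ 6 * hω +
            (1 / 64 : L) * sexticCoeff (-p) * (t + p) ^ 6 * hω').2.1
      rw [map_div₀, map_mul, map_neg, hσp, map_ofNat] at this
      field_simp at this
      exact neg_inj.1 this
    have hσα : σ α = α := by
      have hdet : -α * α - p * γ * (-γ / p) = -1 := by
        field_simp
        linear_combination hγ2
      have h6 : sexticCoeff (-p) * (γ + α) ^ 6 = sexticCoeff p := by
        have h1 : (γ - α) * (γ + α) = -1 := by linear_combination hγ2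
        rw [hsix, mul_right_comm, ← mul_pow, h1]
        norm_num
      -- The antidiagonal automorphism with entries γ - α and -(γ + α) = 1/(γ - α); in the original
      -- coordinates α is its lower right entry.
      exact (h (-α) (p * γ) (-γ / p) α (by rw [hdet]; norm_num) fun t => by
        rw [hdet, show -α * t + p * γ - p * (-γ / p * t + α) = (γ - α) * (t + p) by
            field_simp; ring,
          show -α * t + p * γ + p * (-γ / p * t + α) = -(γ + α) * (t - p) by field_simp; ring]
        linear_combination (t - p) ^ 6 * h6 - (t + p) ^ 6 * hsix).2.2.2
    refine ⟨hσα, ?_, hσs⟩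
    have := congrArg σ hpdef
    rw [map_mul, map_mul, hσp, hσs, map_ofNat, hpdef] at this
    exact (mul_right_cancel₀ hs0 this).symm
  · rintro ⟨hσα, hσr, hσs⟩ a b c e hdet hM
    have hσp : σ p = p := by
      have : p = r * s / 3 := by linear_combination hpdef / 3
      rw [this, map_div₀, map_mul, hσr, hσs, map_ofNat]
    have hσγ : σ γ = γ := by
      rw [hγ]
      simp only [map_div₀, map_mul, map_sub, map_neg, map_pow, map_one, map_ofNat, hσp, hσα]
    have hβ : γ - α ≠ 0 := by
      intro h1
      rw [h1] at hsix
      exact hB (by rw [hsix]; ring)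
    exact apply_matrix_eq (σ := (σ : L →+* L)) hs hσs hp0 hσp hβ
      (by simp [hσγ, hσα]) hA hB hsix hdet hM

theorem autFieldOfDefinition_sexticPoly {L : Type*} [Field L] [CharZero L] [IsGalois ℚ L]
    {d : ℚ} (h0 : d ≠ 0) (h3 : d ≠ 3) (h3' : d ≠ -3) {α r s : L}
    (hα : aeval α (cubicPoly d) = 0) (hr : r ^ 2 = algebraMap ℚ L d) (hs : s ^ 2 = -3) :
    autFieldOfDefinition L (sexticPoly d) = IntermediateField.adjoin ℚ {α, r, s} := by
  rw [autFieldOfDefinition, ← InfiniteGalois.fixedField_fixingSubgroup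
    (IntermediateField.adjoin ℚ {α, r, s})]
  congr 1
  ext σ
  rw [mem_ker_galoisAction_sexticPoly_iff h0 h3 h3' hα hr hs, IntermediateField.fixingSubgroup,
    mem_fixingSubgroup_iff]
  simpa using (IntermediateField.forall_mem_adjoin_smul_eq_self_iff ℚ (S := {α, r, s}) σ).symm

theorem intCast_ne_of_squarefree {d : ℤ} (h : Squarefree d) (h' : d ≠ 3) (h'' : d ≠ -3) :
    (d : ℚ) ≠ 0 ∧ (d : ℚ) ≠ 3 ∧ (d : ℚ) ≠ -3 :=
  ⟨by exact_mod_cast h.ne_zero, by exact_mod_cast h', by exact_mod_cast h''⟩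

/-- The binary sextic forms of different parameters are not equivalent over the rational numbers,
even up to scalars. -/
theorem eq_of_binarySextic_sexticPoly_eq (L : Type*) [Field L] [CharZero L] [IsAlgClosed L]
    {d₁ d₂ : ℤ} (h1 : Squarefree d₁) (h1' : d₁ ≠ 3) (h1'' : d₁ ≠ -3) (h2 : Squarefree d₂)
    (h2' : d₂ ≠ 3) (h2'' : d₂ ≠ -3) {k : ℚ} (hk : k ≠ 0) {a b c e : ℚ}
    (hdet : a * e - b * c ≠ 0)
    (hsextic : (binarySextic (C k⁻¹ * sexticPoly d₁) (C a * X + C b) (C c * X + C e) : ℚ[X]) =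
      C ((a * e - b * c) ^ 2) * sexticPoly d₂) : d₁ = d₂ := by
  obtain ⟨z1, n1, n1'⟩ := intCast_ne_of_squarefree h1 h1' h1''
  obtain ⟨z2, n2, n2'⟩ := intCast_ne_of_squarefree h2 h2' h2''
  have deg2 := natDegree_sexticPoly n2 n2'
  have hroot : ∀ d : ℤ, ∃ p : L, 3 * p ^ 2 = -algebraMap ℚ L d := fun d => by
    obtain ⟨p, hp⟩ := IsAlgClosed.exists_pow_nat_eq (-algebraMap ℚ L d / 3) two_pos
    exact ⟨p, by rw [hp]; ring⟩
  obtain ⟨p₁, hp₁⟩ := hroot d₁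
  obtain ⟨p₂, hp₂⟩ := hroot d₂
  have hne : ∀ {d : ℚ} {p : L}, d ≠ 0 → 3 * p ^ 2 = -algebraMap ℚ L d → p ≠ 0 := by
    rintro d p h0 hp rfl
    apply h0
    apply (algebraMap ℚ L).injective
    rw [map_zero]
    linear_combination hp
  have hform : ∀ t : L, algebraMap ℚ L k⁻¹ * sexticCoeff p₁ *
        ((algebraMap ℚ L a * t + algebraMap ℚ L b) -
          p₁ * (algebraMap ℚ L c * t + algebraMap ℚ L e)) ^ 6 +
      algebraMap ℚ L k⁻¹ * sexticCoeff (-p₁) *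
        ((algebraMap ℚ L a * t + algebraMap ℚ L b) +
          p₁ * (algebraMap ℚ L c * t + algebraMap ℚ L e)) ^ 6 =
      algebraMap ℚ L ((a * e - b * c) ^ 2) *
        (sexticCoeff p₂ * (t - p₂) ^ 6 + sexticCoeff (-p₂) * (t + p₂) ^ 6) := by
    intro t
    have e1 := congrArg (aeval t) hsextic
    have e2 : aeval t (binarySextic (C k⁻¹ * sexticPoly d₁) (C a * X + C b) (C c * X + C e) :
        ℚ[X]) = algebraMap ℚ L k⁻¹ * binarySextic (sexticPoly d₁)
          (algebraMap ℚ L a * t + algebraMap ℚ L b) (algebraMap ℚ L c * t + algebraMap ℚ L e) := by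
      simp only [binarySextic, Finset.mul_sum, map_sum, map_mul, map_pow, map_add, aeval_C, aeval_X,
        coeff_C_mul, mul_assoc, algebraMap_eq]
    have e3 : aeval t (sexticPoly d₂) =
        sexticCoeff p₂ * (t - p₂) ^ 6 + sexticCoeff (-p₂) * (t + p₂) ^ 6 := by
      have := binarySextic_mul (sexticPoly d₂) deg2 t 1
      rw [mul_one, one_pow, mul_one, binarySextic_sexticPoly n2 n2' hp₂, mul_one] at this
      exact this.symm
    rw [e2, binarySextic_sexticPoly n1 n1' hp₁, map_mul, aeval_C, e3] at e1
    rw [← e1]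
    ring
  have hk' : algebraMap ℚ L k⁻¹ ≠ 0 := (_root_.map_ne_zero _).2 (inv_ne_zero hk)
  have hdet' : algebraMap ℚ L a * algebraMap ℚ L e - algebraMap ℚ L b * algebraMap ℚ L c ≠ 0 := by
    rw [← map_mul, ← map_mul, ← map_sub]
    exact (_root_.map_ne_zero _).2 hdet
  have hpm₁ : 3 * (-p₁) ^ 2 = -algebraMap ℚ L d₁ := by rwa [neg_sq]
  obtain ⟨a', b', c', e', k1, k2, -, -, hcase, -, -⟩ := diagonal_or_antidiagonal_of_forall
    (hne z2 hp₂) (mul_ne_zero hk' (sexticCoeff_ne_zero n1' hp₁))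
    (mul_ne_zero hk' (sexticCoeff_ne_zero n1' hpm₁)) (hne z1 hp₁) hdet' hform
  have hsq : ∀ {d : ℤ} {p : L}, 3 * p ^ 2 = -algebraMap ℚ L d →
      p ^ 2 = algebraMap ℚ L (-d / 3) := fun hp => by
    rw [map_div₀, map_neg, map_ofNat, ← hp]
    ring
  -- If -d₂/3 were a square, so would be -3d₂, forcing d₂ = -3.
  have hirr : ¬ IsSquare (-d₂ / 3 : ℚ) := by
    rintro ⟨w, hw⟩
    have h3 : Squarefree (-3 : ℤ) := by
      rw [Int.squarefree_natAbs.symm]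
      exact Nat.prime_three.squarefree
    refine h2'' (eq_of_squarefree_of_mul_eq_ratCast_sq h2 h3 (q := 3 * w) ?_)
    push_cast
    linear_combination 9 * hw
  -- The matrix sends p₂ to p₁ in the diagonal case and -p₂ to p₁ in the antidiagonal one.
  have hmoeb : ∃ p : L, p ^ 2 = algebraMap ℚ L (-d₂ / 3) ∧
      algebraMap ℚ L a * p + algebraMap ℚ L b =
        p₁ * (algebraMap ℚ L c * p + algebraMap ℚ L e) := by
    rcases hcase with ⟨rfl, -⟩ | ⟨rfl, -⟩
    · exact ⟨p₂, hsq hp₂, by linear_combination -p₂ * k1 - k2⟩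
    · exact ⟨-p₂, by rw [neg_sq, hsq hp₂], by linear_combination p₂ * k1 - k2⟩
  obtain ⟨p, hp, hpp⟩ := hmoeb
  obtain ⟨q, hq⟩ := exists_mul_eq_sq_of_moebius hirr
    (div_ne_zero (neg_ne_zero.2 z1) three_ne_zero) hdet hp (hsq hp₁) hpp
  refine eq_of_squarefree_of_mul_eq_ratCast_sq h1 h2 (q := 3 * q) ?_
  linear_combination 9 * hq

theorem eq_of_isHyperellipticTwist_sexticPoly {d₁ d₂ : ℤ} (h1 : Squarefree d₁) (h1' : d₁ ≠ 3)
    (h1'' : d₁ ≠ -3) (h2 : Squarefree d₂) (h2' : d₂ ≠ 3) (h2'' : d₂ ≠ -3)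
    (htwist : IsHyperellipticTwist (sexticPoly d₁) (sexticPoly d₂)) : d₁ = d₂ := by
  obtain ⟨k, hk, ⟨φ⟩⟩ := htwist
  obtain ⟨z1, n1, n1'⟩ := intCast_ne_of_squarefree h1 h1' h1''
  obtain ⟨z2, n2, n2'⟩ := intCast_ne_of_squarefree h2 h2' h2''
  obtain ⟨sep1, sepr1⟩ := separable_sexticPoly z1 n1 n1'
  obtain ⟨sep2, sepr2⟩ := separable_sexticPoly z2 n2 n2'
  have deg1 := natDegree_sexticPoly n1 n1'
  have deg2 := natDegree_sexticPoly n2 n2'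
  have hun : ∀ f : ℚ[X], f.natDegree = 6 → ¬ IsUnit f := fun f hf hu => by
    simp [natDegree_eq_zero_of_isUnit hu] at hf
  have hkC : IsUnit (C k⁻¹ : ℚ[X]) := Polynomial.isUnit_C.2 (inv_ne_zero hk).isUnit
  have dom1 := isDomain_coordinateRing hk sep1.squarefree (hun _ deg1)
  have dom2 := isDomain_coordinateRing (one_ne_zero (α := ℚ)) sep2.squarefree (hun _ deg2)
  obtain ⟨x, y, h⟩ := exists_isPresentation_functionField_one sep2.squarefree (hun _ deg2)
  obtain ⟨x', y', h'⟩ := exists_isPresentation_functionField hk sep1.squarefree (hun _ deg1)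
  -- The isomorphism gives the function field of the second curve another presentation, by k⁻¹ times
  -- the first sextic; the matrix relating the two is rational.
  have hψ := h'.map_algEquiv φ.symm
  have sep1' : (C k⁻¹ * sexticPoly d₁).Separable :=
    sep1.unit_mul hkC
  have sepr1' : (C k⁻¹ * sexticPoly d₁).reverse.Separable := by
    rw [reverse_mul_of_domain, reverse_C]
    exact sepr1.unit_mul hkC
  have deg1' : (C k⁻¹ * sexticPoly d₁).natDegree = 6 := by
    rw [natDegree_C_mul (inv_ne_zero hk), deg1]
  obtain ⟨D, hD⟩ := exists_derivation_of_isPresentation h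
  obtain ⟨a, b, c, e, -, -, -, -, hdet, hsextic⟩ :=
    h.exists_moebius sep2 sepr2 deg2 hψ sep1' sepr1' deg1' hD
  exact eq_of_binarySextic_sexticPoly_eq (AlgebraicClosure ℚ) h1 h1' h1'' h2 h2' h2'' hk hdet
    hsextic

end Main

end Hyperelliptic

theorem mainTheorem4 :
    (∀ d : ℤ, Squarefree d → d ≠ 3 → d ≠ -3 →
      ∀ α r s : AlgebraicClosure ℚ,
        aeval α (cubicPoly d) = 0 → r ^ 2 = (d : AlgebraicClosure ℚ) → s ^ 2 = -3 →
        Hyperelliptic.autFieldOfDefinition (AlgebraicClosure ℚ) (sexticPoly d) =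
          IntermediateField.adjoin ℚ {α, r, s}) ∧
    (∀ d₁ d₂ : ℤ, Squarefree d₁ → d₁ ≠ 3 → d₁ ≠ -3 →
      Squarefree d₂ → d₂ ≠ 3 → d₂ ≠ -3 → d₁ ≠ d₂ →
        ¬ Hyperelliptic.IsHyperellipticTwist (sexticPoly d₁) (sexticPoly d₂)) := by
  refine ⟨fun d hd h3 h3' α r s hα hr hs => ?_, fun d₁ d₂ h1 h1' h1'' h2 h2' h2'' hne h => ?_⟩
  · have : Algebra.IsAlgebraic ℚ (AlgebraicClosure ℚ) := by
      convert! AlgebraicClosure.isAlgebraic ℚ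
    have : IsAlgClosure ℚ (AlgebraicClosure ℚ) := ⟨inferInstance, this⟩
    obtain ⟨n0, n3, n3'⟩ := Hyperelliptic.intCast_ne_of_squarefree hd h3 h3'
    exact Hyperelliptic.autFieldOfDefinition_sexticPoly n0 n3 n3' hα (by rw [hr, map_intCast]) hs
  · exact hne (Hyperelliptic.eq_of_isHyperellipticTwist_sexticPoly h1 h1' h1'' h2 h2' h2'' h)
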